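/- Let $N\ge 1$ and consider $N+1$ qubits $A_1,\dots,A_N,A_{N+1}$. For a set $a$ of qubits let $\vec S_a=\frac12\sum_{i\in a}(\sigma_x^{(i)},\sigma_y^{(i)},\sigma_z^{(i)})$, $S_a^2=\vec S_a\cdot\vec S_a$ and $Z_a=\frac12\sum_{i\in a}\sigma_z^{(i)}$; a state has spin $j$ on $a$ if it is an eigenvector of $S^2_a$ with eigenvalue $j(j+1)$. The Schur states $|k_1,\dots,k_{n-2},j,m\rangle$ of $n$ qubits are obtained by coupling the qubits one after the other with the Clebsch–Gordan coefficients ($|0\rangle$, $|1\rangle$ having $Z$-spin $\pm\frac12$) $$C^{j\pm\frac12,M}_{j,M-\frac12;\frac12,\frac12}=\pm\sqrt{\tfrac12\Bigl(1\pm\tfrac{M}{j+\frac12}\Bigr)},\qquad C^{j\pm\frac12,M}_{j,M+\frac12;\frac12,-\frac12}=\sqrt{\tfrac12\Bigl(1\mp\tfrac{M}{j+\frac12}\Bigr)};$$ here $k_r$ is the spin of the first $r+1$ qubits, $j$ the spin and $m\in\{-j,-j+1,\dots,j\}$ the $Z$-spin of all the qubits, successive spins differ by $\frac12$, one qubit has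 spin $\frac12$ and no qubits have spin $0$. For $N+1$ qubits write $|\tilde k,k_{N-2},j,s,m\rangle$, where $k_{N-2}$, $j$, $s$ are the spins of the first $N-1$, $N$, $N+1$ qubits and $\tilde k$ stands for the spins of the shorter initial segments. Let $|\psi^-\rangle=(|01\rangle-|10\rangle)/\sqrt2$, $\lambda^+_j=2^{-N}(\frac N2+j+1)$, and on $N-1$ qubits $\tilde\Theta=2^{-(N-1)}\sum_{s}\mathbb I(s)/\lambda^+_{s+1/2}$, where $s$ runs over $s_{\min},s_{\min}+1,\dots,\frac{N-1}2$ with $s_{\min}\in\{0,\frac12\}$, $s_{\min}\equiv\frac{N-1}2 \pmod 1$, and $\mathbb I(s)$ is the orthogonal projector onto the spin-$s$ subspace. The POVM of probabilistic port-based teleportation with maximally entangled resource state is $$\Pi_i=|\psi^-\rangle\langle\psi^-|_{A_iA_{N+1}}\otimes\tilde\Theta_{\bar A_i}\quad(1\le i\le N),\qquad \Pi_{N+1}=I-\sum_{i=1}^N\Pi_i,$$ where $\bar A_i$ denotes the ports $A_1,\dots,A_N$ other than $A_i$. Then: 1. The Schur states of the $N+1$ qubits form an orthonormal basis of simultaneous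 eigenvectors of $S^2_{\{1,\dots,r\}}$ ($0\le r\le N+1$) and $Z$, with the eigenvalues given by their labels. 2. For every Schur label $(\tilde k,s,m)$ of the first $N-1$ qubits, of spin $s$, the vector $\sqrt{\frac{s}{2s+1}}\,|\tilde k,s,s-\frac12,s,m\rangle-\sqrt{\frac{s+1}{2s+1}}\,|\tilde k,s,s+\frac12,s,m\rangle$ (for $s=0$ the first term is absent) is an eigenvector of $\Pi_N$ with eigenvalue $\sigma(s)=\frac{4}{N+3+2s}$. The eigenvalue is $0$ elsewhere: the Schur states with $k_{N-2}\ne s$, and, for $s\ge\frac12$, the vectors $\sqrt{\frac{s+1}{2s+1}}\,|\tilde k,s,s-\frac12,s,m\rangle+\sqrt{\frac{s}{2s+1}}\,|\tilde k,s,s+\frac12,s,m\rangle$ are eigenvectors of $\Pi_N$ with eigenvalue $0$, and $\Pi_N$ annihilates every vector orthogonal to all the eigenvectors with eigenvalue $\sigma(s)$ listed above. 3. For $1\le i\le N$, $\Pi_i=\mathrm{SWAP}_{A_iA_N}\Pi_N\,\mathrm{SWAP}_{A_iA_N}$, so $\mathrm{SWAP}_{A_iA_N}$ maps eigenvectors of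 $\Pi_N$ to eigenvectors of $\Pi_i$ with the same eigenvalue. 4. $\Pi_{N+1}$ is diagonal in the Schur basis: a Schur state with $s=j+\frac12$ is an eigenvector with eigenvalue $\tau(s)=\frac{2(2s+1)}{N+3+2s}$, and one with $s=j-\frac12$ is an eigenvector with eigenvalue $0$. -/

import Mathlib

/-!
Spins are stored doubled: a natural number `d` stands for the total spin `d / 2`, an integer `z`
for the `Z`-spin `z / 2`.  The computational state `|0⟩` is `Z`-spin `+1/2`, `|1⟩` is `-1/2`.
Qubits are numbered from `0`.
-/

namespace PBT

noncomputable section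

/-- The Hilbert space `(ℂ²)^{⊗ n}` of `n` qubits, in the computational basis. -/
abbrev Qubits (n : ℕ) : Type := EuclideanSpace ℂ (Fin n → Fin 2)

/-- Operators on `n` qubits, as matrices in the computational basis. -/
abbrev Op (n : ℕ) : Type := Matrix (Fin n → Fin 2) (Fin n → Fin 2) ℂ

/-- The endomorphism of the Hilbert space given by a matrix. -/
abbrev Op.toEnd {n : ℕ} (A : Op n) : Module.End ℂ (Qubits n) := Matrix.toEuclideanLin A

/-! ### Angular momentum -/

/-- The three Pauli matrices `σ_x, σ_y, σ_z`. -/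
def pauli : Fin 3 → Matrix (Fin 2) (Fin 2) ℂ :=
  ![!![0, 1; 1, 0], !![0, -Complex.I; Complex.I, 0], !![1, 0; 0, -1]]

/-- The one-qubit operator `A` acting on qubit `i`, and the identity on the other qubits. -/
def onQubit {n : ℕ} (A : Matrix (Fin 2) (Fin 2) ℂ) (i : Fin n) : Op n :=
  fun x y => if ∀ k, k ≠ i → x k = y k then A (x i) (y i) else 0

/-- Component `c` of the angular momentum `∑_{i ∈ a} S^{(i)}` of the subset `a` of the qubits. -/
def angMom {n : ℕ} (a : Finset (Fin n)) (c : Fin 3) : Op n :=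
  ∑ i ∈ a, (1 / 2 : ℂ) • onQubit (pauli c) i

/-- The total angular momentum operator `S²_a`. -/
def spinSq {n : ℕ} (a : Finset (Fin n)) : Op n :=
  ∑ c : Fin 3, angMom a c * angMom a c

/-- The `Z`-angular momentum operator `Z_a`. -/
def spinZ {n : ℕ} (a : Finset (Fin n)) : Op n := angMom a 2

/-- The eigenvalue `s (s + 1)` of `S²` for the spin `s = d / 2`. -/
def casimir (d : ℕ) : ℂ := ((d : ℂ) / 2) * ((d : ℂ) / 2 + 1)

/-- `𝕀(s)`: the orthogonal projector onto the subspace of `n` qubits with total spin `s = d / 2`. -/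
def spinProj (n d : ℕ) : Op n :=
  Matrix.toEuclideanLin.symm
    ((Module.End.eigenspace (spinSq (Finset.univ : Finset (Fin n))).toEnd
      (casimir d)).starProjection : Qubits n →L[ℂ] Qubits n).toLinearMap

/-! ### The Schur basis -/

/-- Twice the `Z`-spin of the computational state `|b⟩`. -/
def bitZ (b : Fin 2) : ℤ := if b = 0 then 1 else -1

/-- The Clebsch-Gordan coefficient `C^{J, M}_{j, M - x; 1/2, x}` for coupling a spin `j = a / 2`
with a qubit of `Z`-spin `x = ± 1/2` (the bit `b`) to spin `J = a' / 2` and `Z`-spin `M = z / 2`. -/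
def cg (a a' : ℕ) (z : ℤ) (b : Fin 2) : ℝ :=
  let r : ℝ := ((z : ℝ) / 2) / ((a : ℝ) / 2 + 1 / 2)
  if a' = a + 1 then
    (if b = 0 then √(1 / 2 * (1 + r)) else √(1 / 2 * (1 - r)))
  else if a' + 1 = a then
    (if b = 0 then -√(1 / 2 * (1 - r)) else √(1 / 2 * (1 + r)))
  else 0

/-- Amplitudes of the Schur state of `n` qubits whose first `r` qubits have total spin `t r / 2`
for every `r ≤ n`, with `Z`-spin `z / 2`.  The qubits are coupled one after the other:
`|…, j, J, M⟩ = ∑_x C^{J, M}_{j, M - x; 1/2, x} |…, j, M - x⟩ |x⟩`. -/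
def schurAmp : (n : ℕ) → (Fin (n + 1) → ℕ) → ℤ → (Fin n → Fin 2) → ℂ
  | 0, _, z, _ => if z = 0 then 1 else 0
  | n + 1, t, z, x =>
      (cg (t (Fin.last n).castSucc) (t (Fin.last (n + 1))) z (x (Fin.last n)) : ℂ) *
        schurAmp n (fun r => t r.castSucc) (z - bitZ (x (Fin.last n))) (fun i => x i.castSucc)

/-- The Schur state with spins `t` and `Z`-spin `z` (both doubled). -/
def schurState {n : ℕ} (t : Fin (n + 1) → ℕ) (z : ℤ) : Qubits n :=
  WithLp.toLp 2 (schurAmp n t z)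

/-- The admissible labels of the Schur states of `n` qubits: `spin r` is twice the total spin of
the first `r` qubits (`0` for no qubits), successive spins differ by `1/2`, and the `Z`-spin runs
through `-j, -j + 1, …, j`, where `j` is the spin of all the qubits. -/
@[ext]
structure SchurLabel (n : ℕ) where
  spin : Fin (n + 1) → ℕ
  zspin : ℤ
  spin_zero : spin 0 = 0
  spin_step : ∀ i : Fin n,
    spin i.succ = spin i.castSucc + 1 ∨ spin i.succ + 1 = spin i.castSucc
  zspin_le : |zspin| ≤ (spin (Fin.last n) : ℤ)
  zspin_parity : Even (zspin - (spin (Fin.last n) : ℤ))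

/-- The Schur state of an admissible label. -/
def SchurLabel.state {n : ℕ} (l : SchurLabel n) : Qubits n := schurState l.spin l.zspin

/-- Twice the spin of all the qubits. -/
def SchurLabel.total {n : ℕ} (l : SchurLabel n) : ℕ := l.spin (Fin.last n)

/-- For the label `(k̃, s, m)` of `n` qubits, the state `|k̃, s, j, s, m⟩` of `n + 2` qubits, in
which the first `n + 1` qubits have spin `j = a / 2` and all `n + 2` qubits have again spin `s`. -/
def SchurLabel.extend {n : ℕ} (l : SchurLabel n) (a : ℕ) : Qubits (n + 2) :=
  schurState
    (Fin.snoc (α := fun _ => ℕ) (Fin.snoc (α := fun _ => ℕ) l.spin a) l.total) l.zspin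

/-! ### The measurement

There are `N = n + 1` ports `A_1, …, A_N` (the qubits `0, …, n`) and the input qubit `A_{N+1}`
(the qubit `n + 1`). -/

/-- The singlet `|ψ⁻⟩ = (|01⟩ - |10⟩) / √2`. -/
def singlet (a b : Fin 2) : ℂ :=
  if a = 0 ∧ b = 1 then 1 / (√2 : ℝ) else if a = 1 ∧ b = 0 then -(1 / (√2 : ℝ)) else 0

/-- `λ⁺_j = 2^{-N} (N / 2 + j + 1)`. -/
def lambdaPlus (N : ℕ) (j : ℝ) : ℝ := 1 / 2 ^ N * ((N : ℝ) / 2 + j + 1)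

/-- `Θ̃ = 2^{-(N-1)} ∑_s 𝕀(s) / λ⁺_{s + 1/2}` on `N - 1 = n` qubits, where `s = d / 2` runs through
`s_min, s_min + 1, …, (N - 1) / 2`. -/
def theta (n : ℕ) : Op n :=
  (1 / 2 ^ n : ℂ) • ∑ d ∈ (Finset.range (n + 1)).filter (fun d => d % 2 = n % 2),
    ((1 / lambdaPlus (n + 1) ((d : ℝ) / 2 + 1 / 2) : ℝ) : ℂ) • spinProj n d

/-- `Π_i = |ψ⁻⟩⟨ψ⁻|_{A_i A_{N+1}} ⊗ Θ̃_{Ā_i}`, where `Ā_i` are the ports other than `A_i`. -/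
def povm {n : ℕ} (i : Fin (n + 1)) : Op (n + 2) :=
  fun x y =>
    singlet (x i.castSucc) (x (Fin.last (n + 1))) *
      star (singlet (y i.castSucc) (y (Fin.last (n + 1)))) *
      theta n (fun l => x (i.succAbove l).castSucc) (fun l => y (i.succAbove l).castSucc)

/-- The failure element `Π_{N+1} = I - ∑_{i=1}^N Π_i`. -/
def povmFail (n : ℕ) : Op (n + 2) := 1 - ∑ i : Fin (n + 1), povm i

/-- The operator that swaps the qubits `i` and `j`. -/
def swapOp {n : ℕ} (i j : Fin n) : Op n :=
  fun x y => if x = y ∘ Equiv.swap i j then 1 else 0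

/-- `√(s/(2s+1)) |k̃, s, s - 1/2, s, m⟩ - √((s+1)/(2s+1)) |k̃, s, s + 1/2, s, m⟩`.
For `s = 0` there is no state with `j = s - 1/2`; that term has coefficient `0`. -/
def SchurLabel.sigmaVec {n : ℕ} (l : SchurLabel n) : Qubits (n + 2) :=
  let s : ℝ := (l.total : ℝ) / 2
  ((√(s / (2 * s + 1)) : ℝ) : ℂ) • l.extend (l.total - 1) -
    ((√((s + 1) / (2 * s + 1)) : ℝ) : ℂ) • l.extend (l.total + 1)

/-- `√((s+1)/(2s+1)) |k̃, s, s - 1/2, s, m⟩ + √(s/(2s+1)) |k̃, s, s + 1/2, s, m⟩`, used for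
`s ≥ 1/2` only. -/
def SchurLabel.nullVec {n : ℕ} (l : SchurLabel n) : Qubits (n + 2) :=
  let s : ℝ := (l.total : ℝ) / 2
  ((√((s + 1) / (2 * s + 1)) : ℝ) : ℂ) • l.extend (l.total - 1) +
    ((√(s / (2 * s + 1)) : ℝ) : ℂ) • l.extend (l.total + 1)

end

end PBT

/-!
Pairing a Schur state of `n + 2` qubits with the singlet of the last two qubits gives a multiple of
the Schur state of the first `n` qubits, which is zero unless the spin returns to its old value;
the Clebsch–Gordan coefficients then evaluate to `-√(s / (2 s + 1))` and `√((s + 1) / (2 s + 1))`.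
Hence the vectors with eigenvalue `σ(s)` are, up to the sign, the Schur states of the first `n`
qubits with a singlet appended, and `Π_N` vanishes on their orthogonal complement.

Both `I ⊗ ⟨ψ⁻|` and the permutations of the qubits intertwine the total spin, and `Θ̃` is the scalar
`σ(s)` on spin `s`, so on spin `s` the operator `Π_i` is `σ(s)` times the singlet projector
`1/4 - S⃗⁽ⁱ⁾ · S⃗⁽ᴺ⁺¹⁾`. The sum of these projectors over the ports is an affine function of
`S²` of all the qubits minus `S²` of the ports, which is diagonal in the Schur basis.

The Schur states are eigenvectors of `S² = S₋ S₊ + Z² + Z` because `S₊` acts on them by the ladder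
coefficients, which do not depend on the coupling path; this follows by induction over the qubits.
-/

namespace PBT

noncomputable section

open Matrix

variable {n : ℕ}

theorem toEnd_mul_apply (A B : Op n) (v : Qubits n) :
    Op.toEnd (A * B) v = A.toEnd (B.toEnd v) := by
  rw [Op.toEnd, toLpLin_mul_same, LinearMap.comp_apply]

theorem toEnd_one_apply (v : Qubits n) : Op.toEnd 1 v = v := by
  rw [Op.toEnd, toLpLin_one, LinearMap.id_apply]

theorem toEnd_onQubit_apply (A : Matrix (Fin 2) (Fin 2) ℂ) (i : Fin n) (v : Qubits n)
    (x : Fin n → Fin 2) :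
    (onQubit A i).toEnd v x = ∑ b, A (x i) b * v (Function.update x i b) := by
  simp only [toLpLin_apply, mulVec, dotProduct, onQubit, ite_mul, zero_mul]
  rw [← Finset.sum_filter]
  refine (Finset.sum_bij' (fun b _ => Function.update x i b) (fun y _ => y i) ?_ ?_ ?_ ?_ ?_).symm
  · intro b _
    simp +contextual [Function.update_of_ne]
  · simp
  · simp
  · intro y hy
    rw [Finset.mem_filter] at hy
    exact Function.update_eq_iff.2 ⟨rfl, fun k hk => hy.2 k hk⟩
  · simp

theorem onQubit_mul_onQubit (A B : Matrix (Fin 2) (Fin 2) ℂ) (i : Fin n) :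
    onQubit A i * onQubit B i = onQubit (A * B) i := by
  refine toEuclideanLin.injective (LinearMap.ext fun v => PiLp.ext fun x => ?_)
  change Op.toEnd _ v x = Op.toEnd _ v x
  simp only [toEnd_mul_apply, toEnd_onQubit_apply, Function.update_self, Function.update_idem,
    mul_apply, Finset.mul_sum, Finset.sum_mul, mul_assoc]
  exact Finset.sum_comm

theorem onQubit_one (i : Fin n) : onQubit 1 i = 1 := by
  refine toEuclideanLin.injective (LinearMap.ext fun v => PiLp.ext fun x => ?_)
  change Op.toEnd _ v x = Op.toEnd _ v x
  simp [toEnd_onQubit_apply, one_apply]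

theorem onQubit_smul (c : ℂ) (A : Matrix (Fin 2) (Fin 2) ℂ) (i : Fin n) :
    onQubit (c • A) i = c • onQubit A i := by
  ext x y
  simp [onQubit]

theorem onQubit_conjTranspose (A : Matrix (Fin 2) (Fin 2) ℂ) (i : Fin n) :
    (onQubit A i)ᴴ = onQubit Aᴴ i := by
  ext x y
  simp [onQubit, apply_ite star, eq_comm]

theorem commute_onQubit (A B : Matrix (Fin 2) (Fin 2) ℂ) {i j : Fin n} (hij : i ≠ j) :
    Commute (onQubit A i) (onQubit B j) := by
  refine toEuclideanLin.injective (LinearMap.ext fun v => PiLp.ext fun x => ?_)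
  change Op.toEnd _ v x = Op.toEnd _ v x
  simp only [toEnd_mul_apply, toEnd_onQubit_apply, Function.update_of_ne hij,
    Function.update_of_ne hij.symm, Finset.mul_sum]
  rw [Finset.sum_comm]
  refine Finset.sum_congr rfl fun b _ => Finset.sum_congr rfl fun c _ => ?_
  rw [Function.update_comm hij, mul_left_comm]

theorem pauli_isHermitian (c : Fin 3) : (pauli c).IsHermitian := by
  ext i j
  fin_cases c <;> fin_cases i <;> fin_cases j <;> simp [pauli]

theorem pauli_mul_self (c : Fin 3) : pauli c * pauli c = 1 := by
  ext i j
  fin_cases c <;> fin_cases i <;> fin_cases j <;> simp [pauli]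

theorem pauli_zero_mul_pauli_one : pauli 0 * pauli 1 = Complex.I • pauli 2 := by
  ext i j
  fin_cases i <;> fin_cases j <;> simp [pauli]

theorem pauli_one_mul_pauli_zero : pauli 1 * pauli 0 = -Complex.I • pauli 2 := by
  ext i j
  fin_cases i <;> fin_cases j <;> simp [pauli]

theorem angMom_singleton (i : Fin n) (c : Fin 3) :
    angMom {i} c = (1 / 2 : ℂ) • onQubit (pauli c) i :=
  Finset.sum_singleton _ _

theorem angMom_insert {a : Finset (Fin n)} {j : Fin n} (hj : j ∉ a) (c : Fin 3) :
    angMom (insert j a) c = angMom {j} c + angMom a c := by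
  rw [angMom_singleton]
  exact Finset.sum_insert hj

theorem angMom_isHermitian (a : Finset (Fin n)) (c : Fin 3) : (angMom a c).IsHermitian := by
  simp [IsHermitian, angMom, conjTranspose_sum, conjTranspose_smul, onQubit_conjTranspose,
    (pauli_isHermitian c).eq]

theorem spinSq_isHermitian (a : Finset (Fin n)) : (spinSq a).IsHermitian := by
  simp only [IsHermitian, spinSq, conjTranspose_sum, conjTranspose_mul, (angMom_isHermitian a _).eq]

theorem commute_angMom {a b : Finset (Fin n)} (hab : Disjoint a b) (c d : Fin 3) :
    Commute (angMom a c) (angMom b d) :=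
  Commute.sum_left _ _ _ fun i hi => Commute.sum_right _ _ _ fun _ hj =>
    ((commute_onQubit _ _ (Finset.disjoint_iff_ne.1 hab i hi _ hj)).smul_left _).smul_right _

theorem angMom_zero_mul_angMom_one (a : Finset (Fin n)) :
    angMom a 0 * angMom a 1 = angMom a 1 * angMom a 0 + Complex.I • angMom a 2 := by
  induction a using Finset.induction_on with
  | empty => simp [angMom]
  | insert j a hj ih =>
    have single : angMom {j} 0 * angMom {j} 1 =
        angMom {j} 1 * angMom {j} 0 + Complex.I • angMom {j} 2 := by
      simp only [angMom_singleton, smul_mul_smul_comm, onQubit_mul_onQubit,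
        pauli_zero_mul_pauli_one, pauli_one_mul_pauli_zero, onQubit_smul]
      module
    have cross (c d : Fin 3) : angMom {j} c * angMom a d = angMom a d * angMom {j} c :=
      commute_angMom (Finset.disjoint_singleton_left.2 hj) c d
    simp only [angMom_insert hj, add_mul, mul_add, ih, single, smul_add, cross]
    abel

/-- The raising operator `S₊ = S_x + i S_y` of all the qubits. -/
def raise (n : ℕ) : Op n := angMom Finset.univ 0 + Complex.I • angMom Finset.univ 1

theorem spinSq_univ_eq (n : ℕ) :
    spinSq (Finset.univ : Finset (Fin n)) =
      (raise n)ᴴ * raise n + spinZ Finset.univ * spinZ Finset.univ + spinZ Finset.univ := by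
  have hadj : (raise n)ᴴ = angMom Finset.univ 0 - Complex.I • angMom Finset.univ 1 := by
    simp [raise, (angMom_isHermitian _ _).eq, sub_eq_add_neg]
  rw [hadj, raise, spinZ, spinSq, Fin.sum_univ_three, sub_mul, mul_add, mul_add, mul_smul_comm,
    angMom_zero_mul_angMom_one]
  simp only [smul_mul_assoc, mul_smul_comm, smul_add, smul_smul, Complex.I_mul_I]
  module

/-- The map `v ↦ v ⊗ |b⟩`, which appends a qubit. -/
def snocQubit (b : Fin 2) : Qubits n →ₗ[ℂ] Qubits (n + 1) where
  toFun v := WithLp.toLp 2 fun x => if x (Fin.last n) = b then v (Fin.init x) else 0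
  map_add' u v := by ext x; simp [ite_add_zero]
  map_smul' c v := by ext x; simp

/-- The partial inner product `v ↦ (I ⊗ ⟨b|) v` with the last qubit, adjoint to `snocQubit b`. -/
def dropQubit (b : Fin 2) : Qubits (n + 1) →ₗ[ℂ] Qubits n where
  toFun v := WithLp.toLp 2 fun x => v (Fin.snoc (α := fun _ => Fin 2) x b)
  map_add' _ _ := rfl
  map_smul' _ _ := rfl

theorem snocQubit_apply (b : Fin 2) (v : Qubits n) (x : Fin (n + 1) → Fin 2) :
    snocQubit b v x = if x (Fin.last n) = b then v (Fin.init x) else 0 :=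
  rfl

theorem dropQubit_apply (b : Fin 2) (v : Qubits (n + 1)) (x : Fin n → Fin 2) :
    dropQubit b v x = v (Fin.snoc (α := fun _ => Fin 2) x b) :=
  rfl

theorem dropQubit_snocQubit (b c : Fin 2) (v : Qubits n) :
    dropQubit c (snocQubit b v) = if c = b then v else 0 := by
  ext x
  simp only [dropQubit_apply, snocQubit_apply, Fin.snoc_last, Fin.init_snoc]
  split_ifs <;> rfl

theorem sum_snocQubit_dropQubit (v : Qubits (n + 1)) :
    ∑ b, snocQubit b (dropQubit b v) = v := by
  ext x
  simp only [WithLp.ofLp_sum, Finset.sum_apply, snocQubit_apply, dropQubit_apply,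
    Finset.sum_ite_eq, Finset.mem_univ, if_true, Fin.snoc_init_self]

theorem linearMap_ext_snocQubit {M : Type*} [AddCommMonoid M] [Module ℂ M]
    {f g : Qubits (n + 1) →ₗ[ℂ] M} (h : ∀ b, f ∘ₗ snocQubit b = g ∘ₗ snocQubit b) :
    f = g := by
  ext1 v
  rw [← sum_snocQubit_dropQubit v, map_sum, map_sum]
  exact Finset.sum_congr rfl fun b _ => LinearMap.congr_fun (h b) _

theorem inner_snocQubit_left (b : Fin 2) (u : Qubits n) (v : Qubits (n + 1)) :
    inner ℂ (snocQubit b u) v = inner ℂ u (dropQubit b v) := by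
  simp only [PiLp.inner_apply, snocQubit_apply, dropQubit_apply]
  rw [← (Fin.snocEquiv fun _ : Fin (n + 1) => Fin 2).sum_comp, Fintype.sum_prod_type]
  have snocEquiv_apply (c : Fin 2) (x : Fin n → Fin 2) :
      Fin.snocEquiv (fun _ : Fin (n + 1) => Fin 2) (c, x) = Fin.snoc x c := rfl
  simp only [snocEquiv_apply, Fin.snoc_last, Fin.init_snoc]
  rw [Fintype.sum_eq_single b fun c hc => by simp [hc]]
  simp

theorem onQubit_castSucc_snocQubit (A : Matrix (Fin 2) (Fin 2) ℂ) (i : Fin n) (b : Fin 2)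
    (v : Qubits n) :
    (onQubit A i.castSucc).toEnd (snocQubit b v) = snocQubit b ((onQubit A i).toEnd v) := by
  ext x
  simp only [toEnd_onQubit_apply, snocQubit_apply, Function.update_of_ne i.castSucc_lt_last.ne',
    Fin.init_update_castSucc]
  split_ifs <;> simp [Fin.init]

theorem onQubit_last_snocQubit (A : Matrix (Fin 2) (Fin 2) ℂ) (b : Fin 2) (v : Qubits n) :
    (onQubit A (Fin.last n)).toEnd (snocQubit b v) = ∑ c, A c b • snocQubit c v := by
  ext x
  simp [toEnd_onQubit_apply, snocQubit_apply, -Fin.sum_univ_two]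

theorem angMom_map_castSucc_snocQubit (a : Finset (Fin n)) (c : Fin 3) (b : Fin 2)
    (v : Qubits n) :
    (angMom (a.map Fin.castSuccEmb) c).toEnd (snocQubit b v) =
      snocQubit b ((angMom a c).toEnd v) := by
  simp [angMom, onQubit_castSucc_snocQubit]

theorem spinSq_map_castSucc_snocQubit (a : Finset (Fin n)) (b : Fin 2) (v : Qubits n) :
    (spinSq (a.map Fin.castSuccEmb)).toEnd (snocQubit b v) =
      snocQubit b ((spinSq a).toEnd v) := by
  simp only [spinSq, map_sum, LinearMap.sum_apply, toEnd_mul_apply,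
    angMom_map_castSucc_snocQubit]

theorem angMom_univ_snocQubit (c : Fin 3) (b : Fin 2) (v : Qubits n) :
    (angMom Finset.univ c).toEnd (snocQubit b v) =
      snocQubit b ((angMom Finset.univ c).toEnd v) +
        ∑ d, ((1 / 2 : ℂ) * pauli c d b) • snocQubit d v := by
  have hlast : Fin.last n ∉ Finset.univ.map Fin.castSuccEmb := by simp
  rw [Fin.univ_castSuccEmb, Finset.cons_eq_insert, angMom_insert hlast, angMom_singleton]
  simp only [map_add, map_smul, LinearMap.add_apply, LinearMap.smul_apply, onQubit_last_snocQubit,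
    angMom_map_castSucc_snocQubit, Finset.smul_sum, smul_smul]
  exact add_comm _ _

theorem raise_snocQubit (b : Fin 2) (v : Qubits n) :
    (raise (n + 1)).toEnd (snocQubit b v) =
      snocQubit b ((raise n).toEnd v) + if b = 1 then snocQubit 0 v else 0 := by
  have coeff (d : Fin 2) : (1 / 2 : ℂ) * pauli 0 d b + Complex.I * (1 / 2 * pauli 1 d b) =
      if d = 0 ∧ b = 1 then 1 else 0 := by
    fin_cases d <;> fin_cases b <;> simp [pauli, mul_left_comm Complex.I]
    norm_num
  calc (raise (n + 1)).toEnd (snocQubit b v)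
      = snocQubit b ((raise n).toEnd v) + ∑ d, ((1 / 2 : ℂ) * pauli 0 d b +
          Complex.I * (1 / 2 * pauli 1 d b)) • snocQubit d v := by
        simp only [raise, map_add, map_smul, LinearMap.add_apply, LinearMap.smul_apply,
          angMom_univ_snocQubit, Fin.sum_univ_two]
        module
    _ = _ := by simp only [coeff, Fin.sum_univ_two]; simp

theorem spinZ_univ_snocQubit (b : Fin 2) (v : Qubits n) :
    (spinZ Finset.univ).toEnd (snocQubit b v) =
      snocQubit b ((spinZ Finset.univ).toEnd v) + ((bitZ b : ℂ) / 2) • snocQubit b v := by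
  rw [spinZ, angMom_univ_snocQubit, spinZ, Fin.sum_univ_two]
  fin_cases b <;> simp [pauli, bitZ]
  module

/-! ### Clebsch–Gordan coefficients -/

section ClebschGordan

variable (a : ℕ) (z : ℤ)

theorem cg_add_one_zero : cg a (a + 1) z 0 = √(a + 1 + z) / √(2 * (a + 1)) := by
  rw [← Real.sqrt_div' _ (by positivity)]
  simp only [cg, if_true]
  congr 1
  field_simp

theorem cg_add_one_one : cg a (a + 1) z 1 = √(a + 1 - z) / √(2 * (a + 1)) := by
  rw [← Real.sqrt_div' _ (by positivity)]
  simp only [cg, if_true, one_ne_zero, if_false]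
  congr 1
  field_simp

theorem cg_sub_one_zero : cg (a + 1) a z 0 = -(√(a + 2 - z) / √(2 * (a + 2))) := by
  rw [← Real.sqrt_div' _ (by positivity)]
  simp only [cg, if_true, show a ≠ a + 1 + 1 by omega, if_false]
  congr 2
  push_cast
  field_simp
  ring

theorem cg_sub_one_one : cg (a + 1) a z 1 = √(a + 2 + z) / √(2 * (a + 2)) := by
  rw [← Real.sqrt_div' _ (by positivity)]
  simp only [cg, if_true, show a ≠ a + 1 + 1 by omega, one_ne_zero, if_false]
  congr 1
  push_cast
  field_simp
  ring

end ClebschGordan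

/-- `z / 2` is one of the `Z`-spins `-j, -j + 1, …, j` of the spin `j = a / 2`. -/
def IsZSpin (a : ℕ) (z : ℤ) : Prop := |z| ≤ (a : ℤ) ∧ Even (z - a)

theorem bitZ_zero : bitZ 0 = 1 := rfl

theorem bitZ_one : bitZ 1 = -1 := rfl

theorem isZSpin_sub_bitZ_iff {a a' : ℕ} (step : a' = a + 1 ∨ a' + 1 = a) {z : ℤ} {b : Fin 2}
    (hcg : cg a a' z b ≠ 0) : IsZSpin a (z - bitZ b) ↔ IsZSpin a' z := by
  have pos {x y : ℝ} (h : √x / y ≠ 0) : 0 < x := Real.sqrt_ne_zero'.1 (div_ne_zero_iff.1 h).1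
  simp only [IsZSpin, abs_le, Int.even_iff]
  rcases step with rfl | rfl <;> fin_cases b
  · have : 0 < (a : ℤ) + 1 + z := by exact_mod_cast pos (cg_add_one_zero a z ▸ hcg)
    simp only [Fin.zero_eta, bitZ_zero]; omega
  · have : 0 < (a : ℤ) + 1 - z := by exact_mod_cast pos (cg_add_one_one a z ▸ hcg)
    simp only [Fin.mk_one, bitZ_one]; omega
  · have : 0 < (a' : ℤ) + 2 - z := by
      exact_mod_cast pos (neg_ne_zero.1 (cg_sub_one_zero a' z ▸ hcg))
    simp only [Fin.zero_eta, bitZ_zero]; omega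
  · have : 0 < (a' : ℤ) + 2 + z := by exact_mod_cast pos (cg_sub_one_one a' z ▸ hcg)
    simp only [Fin.mk_one, bitZ_one]; omega

/-- The matrix element `√((j - m) (j + m + 1))` of `S₊` between the `Z`-spins `m = z / 2` and
`m + 1` of the spin `j = a / 2`. -/
def ladder (a : ℕ) (z : ℤ) : ℝ := √(a - z) * √(a + z + 2) / 2

theorem cg_one_mul_ladder {a a' : ℕ} (step : a' = a + 1 ∨ a' + 1 = a) (z : ℤ) :
    cg a a' z 1 * ladder a (z + 1) = ladder a' z * cg a a' (z + 2) 1 := by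
  rcases step with rfl | rfl
  · rw [cg_add_one_one, cg_add_one_one, ladder, ladder]
    push_cast
    ring_nf
  · rw [cg_sub_one_one, cg_sub_one_one, ladder, ladder]
    push_cast
    ring_nf

theorem cg_zero_mul_ladder_add_cg_one {a a' : ℕ} (step : a' = a + 1 ∨ a' + 1 = a) {z : ℤ}
    (hz : |z + 1| ≤ (a : ℤ)) :
    cg a a' z 0 * ladder a (z - 1) + cg a a' z 1 = ladder a' z * cg a a' (z + 2) 0 := by
  obtain ⟨hlow, hhigh⟩ := abs_le.1 hz
  rcases step with rfl | rfl
  · rw [cg_add_one_zero, cg_add_one_one, cg_add_one_zero, ladder, ladder]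
    have h₁ : (0 : ℝ) ≤ a + 1 + z := by exact_mod_cast (by omega : 0 ≤ (a : ℤ) + 1 + z)
    have h₃ : (0 : ℝ) ≤ a + 3 + z := by linarith
    push_cast
    rw [show (a : ℝ) - (z - 1) = a + 1 - z by ring, show (a : ℝ) + (z - 1) + 2 = a + 1 + z by ring,
      show (a : ℝ) + 1 + z + 2 = a + 3 + z by ring, show (a : ℝ) + 1 + (z + 2) = a + 3 + z by ring]
    linear_combination √(a + 1 - z) / √(2 * (a + 1)) / 2 *
      (Real.mul_self_sqrt h₁ - Real.mul_self_sqrt h₃)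
  · rw [cg_sub_one_zero, cg_sub_one_one, cg_sub_one_zero, ladder, ladder]
    have h₀ : (0 : ℝ) ≤ a' - z := by
      exact_mod_cast (by push_cast at hhigh; omega : 0 ≤ (a' : ℤ) - z)
    have h₂ : (0 : ℝ) ≤ a' + 2 - z := by linarith
    push_cast
    rw [show (a' : ℝ) + 1 - (z - 1) = a' + 2 - z by ring,
      show (a' : ℝ) + 1 + (z - 1) + 2 = a' + 2 + z by ring,
      show (a' : ℝ) + z + 2 = a' + 2 + z by ring, show (a' : ℝ) + 2 - (z + 2) = a' - z by ring]
    linear_combination √(a' + 2 + z) / √(2 * (a' + 2)) / 2 *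
      (Real.mul_self_sqrt h₀ - Real.mul_self_sqrt h₂)

theorem ladder_mul_self {a : ℕ} {z : ℤ} (hz : |z| ≤ (a : ℤ)) :
    ladder a z * ladder a z = (a - z) * (a + z + 2) / 4 := by
  obtain ⟨hlow, hhigh⟩ := abs_le.1 hz
  have h₁ : (0 : ℝ) ≤ a - z := by exact_mod_cast (by omega : 0 ≤ (a : ℤ) - z)
  have h₂ : (0 : ℝ) ≤ a + z + 2 := by exact_mod_cast (by omega : 0 ≤ (a : ℤ) + z + 2)
  rw [ladder, div_mul_div_comm, mul_mul_mul_comm, Real.mul_self_sqrt h₁, Real.mul_self_sqrt h₂]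
  norm_num

theorem sum_cg_mul_cg {a a' a'' : ℕ} (step' : a' = a + 1 ∨ a' + 1 = a)
    (step'' : a'' = a + 1 ∨ a'' + 1 = a) {z : ℤ} (hz : |z| ≤ (a : ℤ) + 1) :
    ∑ b, cg a a' z b * cg a a'' z b = if a' = a'' then 1 else 0 := by
  obtain ⟨hlow, hhigh⟩ := abs_le.1 hz
  have hplus : (0 : ℝ) ≤ a + 1 + z := by exact_mod_cast (by omega : 0 ≤ (a : ℤ) + 1 + z)
  have hminus : (0 : ℝ) ≤ a + 1 - z := by exact_mod_cast (by omega : 0 ≤ (a : ℤ) + 1 - z)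
  rw [Fin.sum_univ_two]
  rcases step' with rfl | rfl <;> rcases step'' with rfl | h
  · rw [cg_add_one_zero, cg_add_one_one, if_pos rfl, div_mul_div_comm, div_mul_div_comm,
      Real.mul_self_sqrt hplus, Real.mul_self_sqrt hminus, Real.mul_self_sqrt (by positivity)]
    field_simp
    ring
  · subst h
    rw [cg_add_one_zero, cg_add_one_one, cg_sub_one_zero, cg_sub_one_one, if_neg (by omega)]
    push_cast
    ring_nf
  · rw [cg_add_one_zero, cg_add_one_one, cg_sub_one_zero, cg_sub_one_one, if_neg (by omega)]
    push_cast
    ring_nf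
  · obtain rfl : a'' = a' := by omega
    rw [Nat.cast_add_one, add_assoc (a'' : ℝ), one_add_one_eq_two] at hplus hminus
    rw [cg_sub_one_zero, cg_sub_one_one, if_pos rfl, neg_mul_neg, div_mul_div_comm,
      div_mul_div_comm, Real.mul_self_sqrt hplus, Real.mul_self_sqrt hminus,
      Real.mul_self_sqrt (by positivity)]
    field_simp
    ring

theorem cg_zero_one_bitZ (b c : Fin 2) : cg 0 1 (bitZ b) c = if b = c then 1 else 0 := by
  fin_cases b <;> fin_cases c <;> norm_num [cg, bitZ]

theorem cg_completeness {a : ℕ} {z : ℤ} {b : Fin 2} (hz : IsZSpin a (z - bitZ b)) (c : Fin 2) :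
    cg a (a + 1) z b * cg a (a + 1) z c + cg a (a - 1) z b * cg a (a - 1) z c =
      if b = c then 1 else 0 := by
  rcases a with _ | a
  · obtain rfl : z = bitZ b := by simpa [IsZSpin, sub_eq_zero] using hz.1
    have hsub (d : Fin 2) : cg 0 (0 - 1) (bitZ b) d = 0 := by simp [cg]
    simp only [hsub, zero_add, cg_zero_one_bitZ, mul_zero, add_zero, if_true, one_mul]
  · have hz' : |z| ≤ ((a + 1 : ℕ) : ℤ) + 1 := by
      have := hz.1
      fin_cases b <;>
        simp only [Fin.zero_eta, Fin.mk_one, bitZ_zero, bitZ_one, abs_le] at this ⊢ <;> omega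
    let spin : Fin 2 → ℕ := ![a + 2, a]
    let M : Matrix (Fin 2) (Fin 2) ℝ := .of fun i => cg (a + 1) (spin i) z
    have step (i : Fin 2) : spin i = a + 1 + 1 ∨ spin i + 1 = a + 1 := by
      fin_cases i <;> simp [spin]
    have rows : M * M.transpose = 1 := by
      ext i j
      rw [Matrix.one_apply]
      refine (sum_cg_mul_cg (step i) (step j) hz').trans ?_
      fin_cases i <;> fin_cases j <;> simp [spin]
    have columns : (M.transpose * M) b c = (1 : Matrix (Fin 2) (Fin 2) ℝ) b c := by
      rw [mul_eq_one_comm.1 rows]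
    rwa [Matrix.mul_apply, Fin.sum_univ_two, Matrix.one_apply] at columns

/-! ### Schur states -/

/-- The sequence `t` of doubled spins of the initial segments of the qubits starts from `0` and has
successive spins differing by `1/2`. -/
def IsSpinPath (t : Fin (n + 1) → ℕ) : Prop :=
  t 0 = 0 ∧ ∀ i : Fin n, t i.succ = t i.castSucc + 1 ∨ t i.succ + 1 = t i.castSucc

namespace IsSpinPath

theorem init {t : Fin (n + 2) → ℕ} (ht : IsSpinPath t) : IsSpinPath (Fin.init t) :=
  ⟨ht.1, fun i => ht.2 i.castSucc⟩

theorem step_last {t : Fin (n + 2) → ℕ} (ht : IsSpinPath t) :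
    t (Fin.last (n + 1)) = Fin.init t (Fin.last n) + 1 ∨
      t (Fin.last (n + 1)) + 1 = Fin.init t (Fin.last n) :=
  ht.2 (Fin.last n)

theorem snoc {t : Fin (n + 1) → ℕ} (ht : IsSpinPath t) {a : ℕ}
    (ha : a = t (Fin.last n) + 1 ∨ a + 1 = t (Fin.last n)) :
    IsSpinPath (Fin.snoc (α := fun _ => ℕ) t a : Fin (n + 2) → ℕ) := by
  refine ⟨(Fin.snoc_castSucc (α := fun _ => ℕ) a t 0).trans ht.1, fun i => ?_⟩
  induction i using Fin.lastCases with
  | last => simpa [Fin.succ_last] using ha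
  | cast i => simpa only [Fin.succ_castSucc, Fin.snoc_castSucc] using ht.2 i

theorem le_and_parity {t : Fin (n + 1) → ℕ} (ht : IsSpinPath t) :
    t (Fin.last n) ≤ n ∧ t (Fin.last n) % 2 = n % 2 := by
  induction n with
  | zero => simp [ht.1]
  | succ n ih =>
    have := ih ht.init
    have := ht.step_last
    omega

end IsSpinPath

theorem SchurLabel.isSpinPath (l : SchurLabel n) : IsSpinPath l.spin :=
  ⟨l.spin_zero, l.spin_step⟩

theorem SchurLabel.isZSpin (l : SchurLabel n) : IsZSpin l.total l.zspin :=
  ⟨l.zspin_le, l.zspin_parity⟩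

theorem schurState_succ (t : Fin (n + 2) → ℕ) (z : ℤ) :
    schurState t z = ∑ b, (cg (Fin.init t (Fin.last n)) (t (Fin.last (n + 1))) z b : ℂ) •
      snocQubit b (schurState (Fin.init t) (z - bitZ b)) := by
  ext x
  simp only [WithLp.ofLp_sum, WithLp.ofLp_smul, Finset.sum_apply, Pi.smul_apply, snocQubit_apply,
    smul_eq_mul, mul_ite, mul_zero, Finset.sum_ite_eq, Finset.mem_univ, if_true]
  rfl

theorem dropQubit_schurState (t : Fin (n + 2) → ℕ) (z : ℤ) (b : Fin 2) :
    dropQubit b (schurState t z) =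
      (cg (Fin.init t (Fin.last n)) (t (Fin.last (n + 1))) z b : ℂ) •
        schurState (Fin.init t) (z - bitZ b) := by
  simp only [schurState_succ, map_sum, map_smul, dropQubit_snocQubit, smul_ite, smul_zero,
    Finset.sum_ite_eq, Finset.mem_univ, if_true]

theorem isZSpin_zero_iff {z : ℤ} : IsZSpin 0 z ↔ z = 0 := by
  simp +contextual [IsZSpin]

theorem schurState_eq_zero {t : Fin (n + 1) → ℕ} (ht : IsSpinPath t) {z : ℤ}
    (hz : ¬ IsZSpin (t (Fin.last n)) z) : schurState t z = 0 := by
  induction n generalizing z with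
  | zero =>
    rw [show t (Fin.last 0) = 0 from ht.1, isZSpin_zero_iff] at hz
    ext
    exact if_neg hz
  | succ n ih =>
    rw [schurState_succ]
    refine Finset.sum_eq_zero fun b _ => ?_
    by_cases hcg : cg (Fin.init t (Fin.last n)) (t (Fin.last (n + 1))) z b = 0
    · rw [hcg, Complex.ofReal_zero, zero_smul]
    · rw [ih ht.init (mt (isZSpin_sub_bitZ_iff ht.step_last hcg).1 hz), map_zero, smul_zero]

theorem eq_iff_init_eq_and_last_eq {α : Type*} {t t' : Fin (n + 1) → α} :
    t = t' ↔ Fin.init t = Fin.init t' ∧ t (Fin.last n) = t' (Fin.last n) :=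
  ⟨fun h => h ▸ ⟨rfl, rfl⟩, fun h => funext (Fin.lastCases h.2 (congrFun h.1))⟩

theorem inner_schurState {t t' : Fin (n + 1) → ℕ} (ht : IsSpinPath t) (ht' : IsSpinPath t')
    {z : ℤ} (hz : IsZSpin (t (Fin.last n)) z) (z' : ℤ) :
    inner ℂ (schurState t z) (schurState t' z') = if t = t' ∧ z = z' then 1 else 0 := by
  induction n generalizing z z' with
  | zero =>
    have eq_zero (r : Fin 1) : r = 0 := Subsingleton.elim r 0
    obtain rfl : t = t' := by ext r; rw [eq_zero r, ht.1, ht'.1]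
    rw [show t (Fin.last 0) = 0 from ht.1, isZSpin_zero_iff] at hz
    subst hz
    simp [schurState, schurAmp, PiLp.inner_apply, eq_comm]
  | succ n ih =>
    set a := Fin.init t (Fin.last n) with ha
    have term (b : Fin 2) :
        inner ℂ (dropQubit b (schurState t z)) (dropQubit b (schurState t' z')) =
        if Fin.init t = Fin.init t' ∧ z = z' then
          ((cg a (t (Fin.last (n + 1))) z b * cg a (t' (Fin.last (n + 1))) z b : ℝ) : ℂ)
        else 0 := by
      rw [dropQubit_schurState, dropQubit_schurState, inner_smul_left, inner_smul_right,
        Complex.conj_ofReal]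
      by_cases hcg : cg a (t (Fin.last (n + 1))) z b = 0
      · simp [← ha, hcg]
      · rw [ih ht.init ht'.init ((isZSpin_sub_bitZ_iff ht.step_last hcg).2 hz)]
        simp only [sub_left_inj]
        split_ifs with h
        · rw [ha, ← h.1, ← h.2, mul_one, Complex.ofReal_mul]
        · rw [mul_zero, mul_zero]
    have hz' : |z| ≤ (a : ℤ) + 1 := by
      have := hz.1
      have := ht.step_last
      omega
    rw [← sum_snocQubit_dropQubit (schurState t z), sum_inner]
    simp only [inner_snocQubit_left, term, eq_iff_init_eq_and_last_eq (t := t)]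
    by_cases h : Fin.init t = Fin.init t' ∧ z = z'
    · have step' : t' (Fin.last (n + 1)) = a + 1 ∨ t' (Fin.last (n + 1)) + 1 = a := by
        rw [ha, h.1]
        exact ht'.step_last
      simp only [h, and_self, and_true, true_and, if_true, ← Complex.ofReal_sum]
      rw [← h.2, sum_cg_mul_cg ht.step_last step' hz']
      split_ifs <;> simp
    · rw [if_neg fun hne => h ⟨hne.1.1, hne.2⟩]
      simp [h]

theorem snocQubit_schurState {t : Fin (n + 1) → ℕ} {z : ℤ} (hz : IsZSpin (t (Fin.last n)) z)
    (b : Fin 2) :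
    snocQubit b (schurState t z) =
      (cg (t (Fin.last n)) (t (Fin.last n) + 1) (z + bitZ b) b : ℂ) •
        schurState (Fin.snoc (α := fun _ => ℕ) t (t (Fin.last n) + 1)) (z + bitZ b) +
      (cg (t (Fin.last n)) (t (Fin.last n) - 1) (z + bitZ b) b : ℂ) •
        schurState (Fin.snoc (α := fun _ => ℕ) t (t (Fin.last n) - 1)) (z + bitZ b) := by
  rw [← add_sub_cancel_right z (bitZ b)] at hz
  have delta (c : Fin 2) := congrArg Complex.ofReal (cg_completeness hz c)
  simp only [Complex.ofReal_add, Complex.ofReal_mul] at delta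
  simp only [schurState_succ, Fin.init_snoc, Fin.snoc_last, Finset.smul_sum, smul_smul,
    ← Finset.sum_add_distrib, ← add_smul, delta]
  rw [Fintype.sum_eq_single b fun c hc => by simp [hc.symm]]
  simp

namespace SchurLabel

theorem orthonormal_state (n : ℕ) : Orthonormal ℂ (state : SchurLabel n → Qubits n) := by
  classical
  rw [orthonormal_iff_ite]
  intro l l'
  simp only [state, inner_schurState l.isSpinPath l'.isSpinPath l.isZSpin, SchurLabel.ext_iff]

theorem schurState_mem_span {t : Fin (n + 1) → ℕ} (ht : IsSpinPath t) (z : ℤ) :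
    schurState t z ∈ Submodule.span ℂ (Set.range (state : SchurLabel n → Qubits n)) := by
  by_cases hz : IsZSpin (t (Fin.last n)) z
  · exact Submodule.subset_span ⟨⟨t, z, ht.1, ht.2, hz.1, hz.2⟩, rfl⟩
  · rw [schurState_eq_zero ht hz]
    exact Submodule.zero_mem _

theorem snocQubit_state_mem_span (l : SchurLabel n) (b : Fin 2) :
    snocQubit b l.state ∈
      Submodule.span ℂ (Set.range (state : SchurLabel (n + 1) → Qubits (n + 1))) := by
  rw [state, snocQubit_schurState l.isZSpin]
  refine Submodule.add_mem _ (Submodule.smul_mem _ _ <|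
    schurState_mem_span (l.isSpinPath.snoc (.inl rfl)) _) ?_
  obtain h | h := Nat.eq_zero_or_pos (l.spin (Fin.last n))
  · simp [h, cg]
  · exact Submodule.smul_mem _ _ <|
      schurState_mem_span (l.isSpinPath.snoc (.inr (Nat.sub_add_cancel h))) _

theorem span_state (n : ℕ) :
    Submodule.span ℂ (Set.range (state : SchurLabel n → Qubits n)) = ⊤ := by
  induction n with
  | zero =>
    have vacuum (v : Qubits 0) : v = v 0 • schurState (fun _ => 0) 0 := by
      ext x
      simp [Subsingleton.elim x 0, schurState, schurAmp]
    refine eq_top_iff.2 fun v _ => vacuum v ▸ Submodule.smul_mem _ _ (schurState_mem_span ?_ 0)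
    exact ⟨rfl, fun i => i.elim0⟩
  | succ n ih =>
    refine eq_top_iff.2 fun v _ => ?_
    rw [← sum_snocQubit_dropQubit v]
    refine Submodule.sum_mem _ fun b _ => ?_
    have image_le : (Submodule.span ℂ (Set.range (state : SchurLabel n → Qubits n))).map
        (snocQubit b) ≤ Submodule.span ℂ (Set.range state) := by
      rw [Submodule.map_span_le, Set.forall_mem_range]
      exact fun l => snocQubit_state_mem_span l b
    exact image_le (Submodule.mem_map_of_mem (ih ▸ Submodule.mem_top))

/-- The Schur basis of `n` qubits. -/
def basis (n : ℕ) : Module.Basis (SchurLabel n) ℂ (Qubits n) :=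
  Module.Basis.mk (orthonormal_state n).linearIndependent (span_state n).ge

theorem basis_apply (l : SchurLabel n) : basis n l = l.state :=
  Module.Basis.mk_apply _ _ l

theorem state_ne_zero (l : SchurLabel n) : l.state ≠ 0 :=
  (orthonormal_state n).ne_zero l

end SchurLabel

theorem spinZ_schurState (t : Fin (n + 1) → ℕ) (z : ℤ) :
    (spinZ Finset.univ).toEnd (schurState t z) = ((z : ℂ) / 2) • schurState t z := by
  induction n generalizing z with
  | zero =>
    ext x
    simp +contextual [spinZ, angMom, schurState, schurAmp]
  | succ n ih =>
    simp only [schurState_succ, map_sum, map_smul, Finset.smul_sum, spinZ_univ_snocQubit, ih]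
    refine Finset.sum_congr rfl fun b _ => ?_
    push_cast
    module

theorem raise_schurState {t : Fin (n + 1) → ℕ} (ht : IsSpinPath t) (z : ℤ) :
    (raise n).toEnd (schurState t z) =
      (ladder (t (Fin.last n)) z : ℂ) • schurState t (z + 2) := by
  induction n generalizing z with
  | zero =>
    have hzero : raise 0 = 0 := by simp [raise, angMom]
    have hlast : t (Fin.last 0) = 0 := ht.1
    rw [hlast, hzero, Op.toEnd, map_zero, LinearMap.zero_apply]
    obtain rfl | hz := eq_or_ne z (-2)
    · simp [ladder]
    · rw [schurState_eq_zero ht (by rw [hlast, isZSpin_zero_iff]; omega), smul_zero]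
  | succ n ih =>
    set a := Fin.init t (Fin.last n)
    set a' := t (Fin.last (n + 1))
    have coeff_one := congrArg Complex.ofReal (cg_one_mul_ladder ht.step_last z)
    have coeff_zero : ((cg a a' z 0 * ladder a (z - 1) + cg a a' z 1 : ℝ) : ℂ) •
          snocQubit 0 (schurState (Fin.init t) (z + 1)) =
        ((ladder a' z * cg a a' (z + 2) 0 : ℝ) : ℂ) •
          snocQubit 0 (schurState (Fin.init t) (z + 1)) := by
      by_cases hz : IsZSpin a (z + 1)
      · rw [cg_zero_mul_ladder_add_cg_one ht.step_last hz.1]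
      · rw [schurState_eq_zero ht.init hz, map_zero, smul_zero, smul_zero]
    simp only [schurState_succ, map_add, map_smul, raise_snocQubit, ih ht.init, Fin.sum_univ_two,
      zero_ne_one, if_false, if_true, bitZ_zero, bitZ_one, sub_neg_eq_add, add_zero]
    rw [show z - 1 + 2 = z + 1 by ring, show z + 2 - 1 = z + 1 by ring, add_right_comm z 1 2]
    push_cast at coeff_zero coeff_one
    linear_combination (norm := module) coeff_zero +
      coeff_one • snocQubit 1 (schurState (Fin.init t) (z + 2 + 1))

namespace SchurLabel

theorem inner_raise_state (l l' : SchurLabel n) :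
    inner ℂ ((raise n).toEnd l.state) ((raise n).toEnd l'.state) =
      ((l.total - l.zspin) * (l.total + l.zspin + 2) / 4) * inner ℂ l.state l'.state := by
  rw [state, state, raise_schurState l.isSpinPath, raise_schurState l'.isSpinPath,
    inner_smul_left, inner_smul_right, Complex.conj_ofReal,
    inner_schurState l.isSpinPath l'.isSpinPath l.isZSpin]
  by_cases hz : IsZSpin (l.spin (Fin.last n)) (l.zspin + 2)
  · rw [inner_schurState l.isSpinPath l'.isSpinPath hz]
    simp only [add_left_inj]
    split_ifs with h
    · have hladder := congrArg Complex.ofReal (ladder_mul_self l.zspin_le)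
      push_cast at hladder
      rw [← h.1, ← h.2, mul_one, mul_one, hladder, total]
    · simp only [mul_zero]
  · have top : l.zspin = l.total := by
      obtain ⟨hle, heven⟩ := l.isZSpin
      rw [IsZSpin, Int.even_iff, abs_le] at hz
      rw [Int.even_iff] at heven
      rw [total, abs_le] at hle
      rw [total] at heven ⊢
      omega
    rw [schurState_eq_zero l.isSpinPath hz, inner_zero_left, top]
    simp

theorem spinSq_state (l : SchurLabel n) :
    (spinSq Finset.univ).toEnd l.state = casimir l.total • l.state := by
  refine InnerProductSpace.ext_inner_left_basis (basis n) fun l' => ?_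
  have adjoint : inner ℂ l'.state (Op.toEnd (raise n)ᴴ ((raise n).toEnd l.state)) =
      inner ℂ ((raise n).toEnd l'.state) ((raise n).toEnd l.state) := by
    rw [Op.toEnd, toEuclideanLin_conjTranspose_eq_adjoint, LinearMap.adjoint_inner_right]
  have spinZ_state : (spinZ Finset.univ).toEnd l.state = ((l.zspin : ℂ) / 2) • l.state :=
    spinZ_schurState _ _
  rw [basis_apply, spinSq_univ_eq]
  simp only [map_add, LinearMap.add_apply, toEnd_mul_apply, spinZ_state, map_smul, inner_add_right,
    inner_smul_right, adjoint, inner_raise_state]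
  obtain rfl | hne := eq_or_ne l' l
  · rw [casimir]
    ring
  · rw [(orthonormal_state n).inner_eq_zero hne]
    ring

end SchurLabel

theorem spinSq_univ_schurState {t : Fin (n + 1) → ℕ} (ht : IsSpinPath t) (z : ℤ) :
    (spinSq Finset.univ).toEnd (schurState t z) =
      casimir (t (Fin.last n)) • schurState t z := by
  by_cases hz : IsZSpin (t (Fin.last n)) z
  · exact SchurLabel.spinSq_state ⟨t, z, ht.1, ht.2, hz.1, hz.2⟩
  · rw [schurState_eq_zero ht hz, map_zero, smul_zero]

theorem filter_lt_eq_map_castSucc {r : ℕ} (hr : r ≤ n) :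
    (Finset.univ.filter fun i : Fin (n + 1) => (i : ℕ) < r) =
      (Finset.univ.filter fun i : Fin n => (i : ℕ) < r).map Fin.castSuccEmb := by
  ext i
  induction i using Fin.lastCases with
  | last => simpa [Fin.castSucc_ne_last] using hr
  | cast i => simp

theorem spinSq_filter_lt_schurState {t : Fin (n + 1) → ℕ} (ht : IsSpinPath t) (r : Fin (n + 1))
    (z : ℤ) :
    (spinSq (Finset.univ.filter fun i : Fin n => (i : ℕ) < r)).toEnd (schurState t z) =
      casimir (t r) • schurState t z := by
  induction n generalizing z with
  | zero =>
    obtain rfl : r = Fin.last 0 := Subsingleton.elim (α := Fin 1) _ _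
    rw [Finset.filter_true_of_mem fun i _ => i.is_lt]
    exact spinSq_univ_schurState ht z
  | succ n ih =>
    induction r using Fin.lastCases with
    | last =>
      rw [Finset.filter_true_of_mem fun i _ => i.is_lt]
      exact spinSq_univ_schurState ht z
    | cast r =>
      simp only [Fin.val_castSucc, filter_lt_eq_map_castSucc r.is_le, schurState_succ, map_sum,
        map_smul, spinSq_map_castSucc_snocQubit, ih ht.init, Finset.smul_sum]
      exact Finset.sum_congr rfl fun b _ => smul_comm _ _ _

namespace SchurLabel

theorem hasEigenvector_spinSq (l : SchurLabel n) (r : Fin (n + 1)) :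
    Module.End.HasEigenvector
      (spinSq (Finset.univ.filter fun i : Fin n => (i : ℕ) < r)).toEnd
      (casimir (l.spin r)) l.state :=
  Module.End.hasEigenvector_iff.2
    ⟨Module.End.mem_eigenspace_iff.2 (spinSq_filter_lt_schurState l.isSpinPath r _),
      l.state_ne_zero⟩

theorem hasEigenvector_spinZ (l : SchurLabel n) :
    Module.End.HasEigenvector (spinZ (Finset.univ : Finset (Fin n))).toEnd ((l.zspin : ℂ) / 2)
      l.state :=
  Module.End.hasEigenvector_iff.2
    ⟨Module.End.mem_eigenspace_iff.2 (spinZ_schurState _ _), l.state_ne_zero⟩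

end SchurLabel

/-! ### The operator `Θ̃` -/

theorem casimir_injective : Function.Injective casimir := by
  intro d e h
  have cast_eq : ((d * (d + 2) : ℕ) : ℂ) = ((e * (e + 2) : ℕ) : ℂ) := by
    simp only [casimir] at h
    push_cast
    linear_combination 4 * h
  have nat_eq : d * (d + 2) = e * (e + 2) := Nat.cast_injective cast_eq
  nlinarith [lt_trichotomy d e]

theorem inner_eq_zero_of_spinSq {d e : ℕ} (hde : d ≠ e) {a : Finset (Fin n)} {v w : Qubits n}
    (hv : (spinSq a).toEnd v = casimir d • v) (hw : (spinSq a).toEnd w = casimir e • w) :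
    inner ℂ v w = 0 := by
  have symm : (spinSq a).toEnd.IsSymmetric :=
    isSymmetric_toEuclideanLin_iff.2 (spinSq_isHermitian a)
  exact symm.orthogonalFamily_eigenspaces (casimir_injective.ne hde)
    ⟨v, Module.End.mem_eigenspace_iff.2 hv⟩ ⟨w, Module.End.mem_eigenspace_iff.2 hw⟩

theorem eq_zero_of_spinSq {d : ℕ} (hd : ¬ (d ≤ n ∧ d % 2 = n % 2)) {w : Qubits n}
    (hw : (spinSq Finset.univ).toEnd w = casimir d • w) : w = 0 := by
  refine InnerProductSpace.ext_inner_left_basis (SchurLabel.basis n) fun l => ?_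
  have total_ne : l.total ≠ d := by
    rintro rfl
    exact hd l.isSpinPath.le_and_parity
  rw [inner_zero_right, SchurLabel.basis_apply,
    inner_eq_zero_of_spinSq total_ne l.spinSq_state hw]

theorem spinProj_of_spinSq {d : ℕ} {w : Qubits n}
    (hw : (spinSq Finset.univ).toEnd w = casimir d • w) (e : ℕ) :
    (spinProj n e).toEnd w = if e = d then w else 0 := by
  have toEnd_apply : (spinProj n e).toEnd w =
      (Module.End.eigenspace (spinSq Finset.univ).toEnd (casimir e)).starProjection w :=
    LinearMap.congr_fun (toEuclideanLin.apply_symm_apply _) w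
  rw [toEnd_apply]
  split_ifs with hed
  · exact Submodule.starProjection_eq_self_iff.2 (Module.End.mem_eigenspace_iff.2 (hed ▸ hw))
  · exact (Submodule.starProjection_apply_eq_zero_iff _).2 <| (Submodule.mem_orthogonal _ _).2
      fun u hu => inner_eq_zero_of_spinSq hed (Module.End.mem_eigenspace_iff.1 hu) hw

/-- The eigenvalue `σ(s) = 4 / (N + 3 + 2 s)` of `Π_N` for the spin `s = d / 2`. -/
def sigma (N d : ℕ) : ℂ := 4 / ((N : ℂ) + 3 + 2 * ((d : ℂ) / 2))

theorem natCast_add_three_ne_zero (N d : ℕ) : (N : ℂ) + 3 + 2 * ((d : ℂ) / 2) ≠ 0 := by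
  rw [mul_div_cancel₀ _ two_ne_zero]
  exact_mod_cast (by omega : N + 3 + d ≠ 0)

theorem inv_lambdaPlus (n d : ℕ) :
    (1 / 2 ^ n : ℂ) * ((1 / lambdaPlus (n + 1) ((d : ℝ) / 2 + 1 / 2) : ℝ) : ℂ) =
      sigma (n + 1) d := by
  have factor : ((n + 1 : ℕ) : ℂ) / 2 + (d / 2 + 1 / 2) + 1 =
      (((n + 1 : ℕ) : ℂ) + 3 + 2 * (d / 2)) / 2 := by ring
  have := natCast_add_three_ne_zero (n + 1) d
  rw [lambdaPlus, sigma]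
  push_cast at factor this ⊢
  rw [factor, pow_succ]
  field_simp
  norm_num

theorem theta_of_spinSq {d : ℕ} {w : Qubits n}
    (hw : (spinSq Finset.univ).toEnd w = casimir d • w) :
    (theta n).toEnd w = sigma (n + 1) d • w := by
  by_cases hd : d ≤ n ∧ d % 2 = n % 2
  · have mem : d ∈ (Finset.range (n + 1)).filter fun d => d % 2 = n % 2 :=
      Finset.mem_filter.2 ⟨Finset.mem_range_succ_iff.2 hd.1, hd.2⟩
    simp only [theta, map_smul, map_sum, LinearMap.smul_apply, LinearMap.sum_apply,
      spinProj_of_spinSq hw]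
    rw [Finset.sum_eq_single_of_mem d mem fun e _ hed => by rw [if_neg hed, smul_zero], if_pos rfl,
      smul_smul, inv_lambdaPlus]
  · rw [eq_zero_of_spinSq hd hw, map_zero, smul_zero]

/-! ### Contraction with the singlet -/

/-- The map `v ↦ v ⊗ |ψ⁻⟩`, which appends a singlet. -/
def singletExt : Qubits n →ₗ[ℂ] Qubits (n + 2) :=
  ∑ b, ∑ c, singlet b c • snocQubit c ∘ₗ snocQubit b

/-- The partial inner product `v ↦ (I ⊗ ⟨ψ⁻|) v` with the last two qubits, adjoint to
`singletExt`. -/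
def singletContract : Qubits (n + 2) →ₗ[ℂ] Qubits n :=
  ∑ b, ∑ c, star (singlet b c) • dropQubit b ∘ₗ dropQubit c

theorem singletExt_eq_sum (v : Qubits n) :
    singletExt v = ∑ b, ∑ c, singlet b c • snocQubit c (snocQubit b v) := by
  simp only [singletExt, LinearMap.sum_apply, LinearMap.smul_apply, LinearMap.comp_apply]

theorem singletContract_eq_sum (v : Qubits (n + 2)) :
    singletContract v = ∑ b, ∑ c, star (singlet b c) • dropQubit b (dropQubit c v) := by
  simp only [singletContract, LinearMap.sum_apply, LinearMap.smul_apply, LinearMap.comp_apply]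

theorem singletExt_apply (v : Qubits n) (x : Fin (n + 2) → Fin 2) :
    singletExt v x =
      singlet (x (Fin.last n).castSucc) (x (Fin.last (n + 1))) * v (Fin.init (Fin.init x)) := by
  simp only [singletExt_eq_sum, WithLp.ofLp_sum, WithLp.ofLp_smul, Finset.sum_apply, Pi.smul_apply,
    snocQubit_apply, smul_eq_mul, mul_ite, mul_zero, Finset.sum_ite_eq, Finset.mem_univ, if_true]
  rfl

theorem singletContract_apply (v : Qubits (n + 2)) (x : Fin n → Fin 2) :
    singletContract v x = ∑ b, ∑ c, star (singlet b c) *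
      v (Fin.snoc (α := fun _ => Fin 2) (Fin.snoc (α := fun _ => Fin 2) x b) c) := by
  simp only [singletContract_eq_sum, WithLp.ofLp_sum, WithLp.ofLp_smul, Finset.sum_apply,
    Pi.smul_apply, dropQubit_apply, smul_eq_mul]

theorem inner_singletExt_left (u : Qubits n) (v : Qubits (n + 2)) :
    inner ℂ (singletExt u) v = inner ℂ u (singletContract v) := by
  simp only [singletExt_eq_sum, singletContract_eq_sum, sum_inner, inner_sum, inner_smul_left,
    inner_smul_right, inner_snocQubit_left, starRingEnd_apply]

theorem inv_sqrt_two_mul_inv_sqrt_two : ((√2 : ℝ) : ℂ)⁻¹ * ((√2 : ℝ) : ℂ)⁻¹ = 1 / 2 := by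
  rw [← mul_inv, ← Complex.ofReal_mul, Real.mul_self_sqrt zero_le_two, Complex.ofReal_ofNat,
    one_div]

theorem singletContract_singletExt (v : Qubits n) : singletContract (singletExt v) = v := by
  suffices ((√2 : ℝ) : ℂ)⁻¹ • ((√2 : ℝ) : ℂ)⁻¹ • v + ((√2 : ℝ) : ℂ)⁻¹ • ((√2 : ℝ) : ℂ)⁻¹ • v = v by
    simpa [singletExt_eq_sum, singletContract_eq_sum, dropQubit_snocQubit, singlet]
  rw [smul_smul, inv_sqrt_two_mul_inv_sqrt_two]
  module

theorem norm_singletExt (v : Qubits n) : ‖singletExt v‖ = ‖v‖ := by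
  rw [@norm_eq_sqrt_re_inner ℂ, @norm_eq_sqrt_re_inner ℂ, inner_singletExt_left,
    singletContract_singletExt]

theorem angMom_singletExt (c : Fin 3) (v : Qubits n) :
    (angMom Finset.univ c).toEnd (singletExt v) =
      singletExt ((angMom Finset.univ c).toEnd v) := by
  simp only [singletExt_eq_sum, map_sum, map_smul, map_add, angMom_univ_snocQubit]
  fin_cases c <;> simp [singlet, pauli] <;> module

theorem spinSq_singletExt (v : Qubits n) :
    (spinSq Finset.univ).toEnd (singletExt v) = singletExt ((spinSq Finset.univ).toEnd v) := by
  simp only [spinSq, map_sum, LinearMap.sum_apply, toEnd_mul_apply, angMom_singletExt]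

theorem spinSq_singletContract (v : Qubits (n + 2)) :
    (spinSq Finset.univ).toEnd (singletContract v) =
      singletContract ((spinSq Finset.univ).toEnd v) := by
  have symm (m : ℕ) : (spinSq (Finset.univ : Finset (Fin m))).toEnd.IsSymmetric :=
    isSymmetric_toEuclideanLin_iff.2 (spinSq_isHermitian _)
  refine ext_inner_left ℂ fun u => ?_
  rw [← symm n, ← inner_singletExt_left, ← inner_singletExt_left, ← symm (n + 2),
    spinSq_singletExt]

theorem povm_last_apply (v : Qubits (n + 2)) :
    (povm (Fin.last n)).toEnd v = singletExt ((theta n).toEnd (singletContract v)) := by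
  ext x
  have theta_apply (w : Qubits n) (u : Fin n → Fin 2) :
      (theta n).toEnd w u = ∑ y, theta n u y * w y := rfl
  change ∑ y, povm (Fin.last n) x y * v y = _
  rw [singletExt_apply, theta_apply]
  simp only [← (Fin.snocEquiv fun _ => Fin 2).sum_comp, Fintype.sum_prod_type, Fin.snocEquiv,
    Equiv.coe_fn_mk, singletContract_apply, povm, Fin.snoc_last, Fin.snoc_castSucc,
    Fin.succAbove_last, Finset.mul_sum]
  rw [Finset.sum_comm_cycle]
  refine Finset.sum_congr rfl fun y _ => Finset.sum_comm.trans <|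
    Finset.sum_congr rfl fun b _ => Finset.sum_congr rfl fun c _ => ?_
  change _ * theta n (Fin.init (Fin.init x)) y *
    v (Fin.snoc (α := fun _ => Fin 2) (Fin.snoc (α := fun _ => Fin 2) y b) c) = _
  ring

theorem povm_last_of_spinSq {d : ℕ} {v : Qubits (n + 2)}
    (hv : (spinSq Finset.univ).toEnd v = casimir d • v) :
    (povm (Fin.last n)).toEnd v = sigma (n + 1) d • singletExt (singletContract v) := by
  have hw : (spinSq Finset.univ).toEnd (singletContract v) = casimir d • singletContract v := by
    rw [spinSq_singletContract, hv, map_smul]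
  rw [povm_last_apply, theta_of_spinSq hw, map_smul]

/-! ### The eigenvectors of `Π_N` -/

/-- `√(s / (2 s + 1))` for `s = d / 2`. -/
def lowerCoeff (d : ℕ) : ℝ := √((d : ℝ) / 2 / (2 * ((d : ℝ) / 2) + 1))

/-- `√((s + 1) / (2 s + 1))` for `s = d / 2`. -/
def upperCoeff (d : ℕ) : ℝ := √(((d : ℝ) / 2 + 1) / (2 * ((d : ℝ) / 2) + 1))

theorem lowerCoeff_zero : lowerCoeff 0 = 0 := by
  simp [lowerCoeff]

theorem lowerCoeff_sq_add_upperCoeff_sq (d : ℕ) : lowerCoeff d ^ 2 + upperCoeff d ^ 2 = 1 := by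
  rw [lowerCoeff, upperCoeff, Real.sq_sqrt (by positivity), Real.sq_sqrt (by positivity)]
  field_simp
  ring

theorem lowerCoeff_succ (a : ℕ) : lowerCoeff (a + 1) = √(a + 1) / √(2 * (a + 2)) := by
  rw [lowerCoeff, ← Real.sqrt_div (by positivity)]
  congr 1
  push_cast
  field_simp
  ring

theorem upperCoeff_eq (a : ℕ) : upperCoeff a = √(a + 2) / √(2 * (a + 1)) := by
  rw [upperCoeff, ← Real.sqrt_div (by positivity)]
  congr 1
  field_simp

/-- The coefficient of the Schur state of the first `n` qubits in the contraction with the singlet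
of a Schur state of `n + 2` qubits with spins `a / 2`, `b / 2`, `c / 2` of the first `n`, `n + 1`,
`n + 2` qubits. -/
def singletOverlap (a b c : ℕ) (z : ℤ) : ℝ :=
  (cg b c z 1 * cg a b (z + 1) 0 - cg b c z 0 * cg a b (z - 1) 1) / √2

theorem singletContract_schurState (t : Fin (n + 3) → ℕ) (z : ℤ) :
    singletContract (schurState t z) =
      (singletOverlap (Fin.init (Fin.init t) (Fin.last n)) (Fin.init t (Fin.last (n + 1)))
        (t (Fin.last (n + 2))) z : ℂ) • schurState (Fin.init (Fin.init t)) z := by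
  simp [singletContract_eq_sum, dropQubit_schurState, singlet, singletOverlap, bitZ_zero, bitZ_one]
  module

theorem singletOverlap_eq_zero {a b c : ℕ} (hab : b = a + 1 ∨ b + 1 = a)
    (hbc : c = b + 1 ∨ c + 1 = b) (hac : a ≠ c) (z : ℤ) : singletOverlap a b c z = 0 := by
  rcases hab with rfl | rfl <;> rcases hbc with rfl | hc
  · rw [singletOverlap, cg_add_one_zero, cg_add_one_zero, cg_add_one_one, cg_add_one_one]
    push_cast
    ring_nf
  · exact absurd (Nat.succ_injective hc).symm hac
  · exact absurd rfl hac
  · subst hc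
    rw [singletOverlap, cg_sub_one_zero, cg_sub_one_zero, cg_sub_one_one, cg_sub_one_one]
    push_cast
    ring_nf

theorem two_mul_div_sqrt_two_mul_sqrt (x : ℝ) : 2 * x / (√2 * √(2 * x)) = √x := by
  rw [Real.sqrt_mul zero_le_two, ← mul_assoc, Real.mul_self_sqrt zero_le_two,
    mul_div_mul_left _ _ two_ne_zero, Real.div_sqrt]

theorem singletOverlap_add_one {a : ℕ} {z : ℤ} (hz : |z| ≤ (a : ℤ)) :
    singletOverlap a (a + 1) a z = upperCoeff a := by
  obtain ⟨hlow, hhigh⟩ := abs_le.1 hz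
  have hplus : (0 : ℝ) ≤ a + 2 + z := by exact_mod_cast (by omega : 0 ≤ (a : ℤ) + 2 + z)
  have hminus : (0 : ℝ) ≤ a + 2 - z := by exact_mod_cast (by omega : 0 ≤ (a : ℤ) + 2 - z)
  rw [singletOverlap, cg_add_one_zero, cg_add_one_one, cg_sub_one_zero, cg_sub_one_one,
    upperCoeff_eq]
  push_cast
  rw [show (a : ℝ) + 1 + (z + 1) = a + 2 + z by ring,
    show (a : ℝ) + 1 - (z - 1) = a + 2 - z by ring]
  calc _ = (√(a + 2 + z) * √(a + 2 + z) + √(a + 2 - z) * √(a + 2 - z)) /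
        (√2 * √(2 * (a + 2))) / √(2 * (a + 1)) := by ring
    _ = 2 * (a + 2) / (√2 * √(2 * (a + 2))) / √(2 * (a + 1)) := by
      rw [Real.mul_self_sqrt hplus, Real.mul_self_sqrt hminus]
      ring
    _ = _ := by rw [two_mul_div_sqrt_two_mul_sqrt]

theorem singletOverlap_sub_one {a : ℕ} {z : ℤ} (hz : |z| ≤ (a : ℤ) + 1) :
    singletOverlap (a + 1) a (a + 1) z = -lowerCoeff (a + 1) := by
  obtain ⟨hlow, hhigh⟩ := abs_le.1 hz
  have hplus : (0 : ℝ) ≤ a + 1 + z := by exact_mod_cast (by omega : 0 ≤ (a : ℤ) + 1 + z)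
  have hminus : (0 : ℝ) ≤ a + 1 - z := by exact_mod_cast (by omega : 0 ≤ (a : ℤ) + 1 - z)
  rw [singletOverlap, cg_add_one_zero, cg_add_one_one, cg_sub_one_zero, cg_sub_one_one,
    lowerCoeff_succ]
  push_cast
  rw [show (a : ℝ) + 2 - (z + 1) = a + 1 - z by ring,
    show (a : ℝ) + 2 + (z - 1) = a + 1 + z by ring]
  calc _ = -((√(a + 1 + z) * √(a + 1 + z) + √(a + 1 - z) * √(a + 1 - z)) /
        (√2 * √(2 * (a + 1))) / √(2 * (a + 2))) := by ring
    _ = -(2 * (a + 1) / (√2 * √(2 * (a + 1))) / √(2 * (a + 2))) := by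
      rw [Real.mul_self_sqrt hplus, Real.mul_self_sqrt hminus]
      ring
    _ = _ := by rw [two_mul_div_sqrt_two_mul_sqrt]

theorem hasEigenvector_povm_last_zero {v : Qubits (n + 2)} (hv : v ≠ 0)
    (h : singletContract v = 0) :
    Module.End.HasEigenvector (povm (Fin.last n)).toEnd 0 v := by
  refine Module.End.hasEigenvector_iff.2 ⟨Module.End.mem_eigenspace_iff.2 ?_, hv⟩
  rw [povm_last_apply, h, map_zero, map_zero, zero_smul]

namespace SchurLabel

theorem hasEigenvector_povm_last_state {l : SchurLabel (n + 2)}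
    (hl : l.spin (Fin.last n).castSucc.castSucc ≠ l.total) :
    Module.End.HasEigenvector (povm (Fin.last n)).toEnd 0 l.state := by
  refine hasEigenvector_povm_last_zero l.state_ne_zero ?_
  rw [state, singletContract_schurState, singletOverlap_eq_zero l.isSpinPath.init.step_last
    l.isSpinPath.step_last hl, Complex.ofReal_zero, zero_smul]

theorem singletContract_extend (l : SchurLabel n) (a : ℕ) :
    singletContract (l.extend a) = (singletOverlap l.total a l.total l.zspin : ℂ) • l.state := by
  simp only [extend, singletContract_schurState, Fin.init_snoc, Fin.snoc_last]
  rfl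

theorem singletContract_extend_add_one (l : SchurLabel n) :
    singletContract (l.extend (l.total + 1)) = (upperCoeff l.total : ℂ) • l.state := by
  rw [singletContract_extend, singletOverlap_add_one l.isZSpin.1]

theorem singletContract_extend_sub_one {l : SchurLabel n} (hl : l.total ≠ 0) :
    singletContract (l.extend (l.total - 1)) = (-lowerCoeff l.total : ℂ) • l.state := by
  obtain ⟨a, ha⟩ := Nat.exists_eq_succ_of_ne_zero hl
  have hz : |l.zspin| ≤ (a : ℤ) + 1 := by exact_mod_cast ha ▸ l.isZSpin.1
  rw [singletContract_extend, ha, Nat.succ_sub_one, Nat.succ_eq_add_one,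
    singletOverlap_sub_one hz, Complex.ofReal_neg]

theorem inner_extend (l : SchurLabel n) {a b : ℕ} (ha : a = l.total + 1 ∨ a + 1 = l.total)
    (hb : b = l.total + 1 ∨ b + 1 = l.total) :
    inner ℂ (l.extend a) (l.extend b) = if a = b then 1 else 0 := by
  have path {a : ℕ} (ha : a = l.total + 1 ∨ a + 1 = l.total) :
      IsSpinPath (Fin.snoc (α := fun _ => ℕ) (Fin.snoc (α := fun _ => ℕ) l.spin a) l.total :
        Fin (n + 3) → ℕ) :=
    (l.isSpinPath.snoc ha).snoc (by rw [Fin.snoc_last]; omega)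
  rw [extend, extend, inner_schurState (path ha) (path hb) (by rw [Fin.snoc_last]; exact l.isZSpin)]
  simp [Fin.snoc_inj]

theorem norm_sq_smul_extend {l : SchurLabel n} {α : ℂ} (hα : l.total = 0 → α = 0) (β : ℂ) :
    ‖α • l.extend (l.total - 1) + β • l.extend (l.total + 1)‖ ^ 2 = ‖α‖ ^ 2 + ‖β‖ ^ 2 := by
  have hupper : ‖l.extend (l.total + 1)‖ = 1 := by
    rw [@norm_eq_sqrt_re_inner ℂ, l.inner_extend (.inl rfl) (.inl rfl)]
    simp
  obtain h | h := Nat.eq_zero_or_pos l.total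
  · simp [hα h, norm_smul, hupper]
  · have hstep := Nat.sub_add_cancel h
    have hlower : ‖l.extend (l.total - 1)‖ = 1 := by
      rw [@norm_eq_sqrt_re_inner ℂ, l.inner_extend (.inr hstep) (.inr hstep)]
      simp
    have horth : inner ℂ (α • l.extend (l.total - 1)) (β • l.extend (l.total + 1)) = 0 := by
      rw [inner_smul_left, inner_smul_right, l.inner_extend (.inr hstep) (.inl rfl),
        if_neg (by omega), mul_zero, mul_zero]
    rw [sq, norm_add_sq_eq_norm_sq_add_norm_sq_of_inner_eq_zero _ _ horth]
    simp only [norm_smul, hlower, hupper, mul_one, sq]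

theorem sigmaVec_eq (l : SchurLabel n) :
    l.sigmaVec = (lowerCoeff l.total : ℂ) • l.extend (l.total - 1) -
      (upperCoeff l.total : ℂ) • l.extend (l.total + 1) :=
  rfl

theorem nullVec_eq (l : SchurLabel n) :
    l.nullVec = (upperCoeff l.total : ℂ) • l.extend (l.total - 1) +
      (lowerCoeff l.total : ℂ) • l.extend (l.total + 1) :=
  rfl

theorem norm_sigmaVec (l : SchurLabel n) : ‖l.sigmaVec‖ = 1 := by
  rw [← sq_eq_sq₀ (norm_nonneg _) zero_le_one, sigmaVec_eq, sub_eq_add_neg, ← neg_smul,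
    norm_sq_smul_extend fun h => by rw [h, lowerCoeff_zero, Complex.ofReal_zero]]
  simp [lowerCoeff_sq_add_upperCoeff_sq]

theorem nullVec_ne_zero {l : SchurLabel n} (hl : l.total ≠ 0) : l.nullVec ≠ 0 := by
  rw [← norm_ne_zero_iff, ← sq_eq_zero_iff.ne, nullVec_eq,
    norm_sq_smul_extend fun h => absurd h hl]
  simp [add_comm, lowerCoeff_sq_add_upperCoeff_sq]

theorem singletContract_sigmaVec (l : SchurLabel n) : singletContract l.sigmaVec = -l.state := by
  have lower : (lowerCoeff l.total : ℂ) • singletContract (l.extend (l.total - 1)) =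
      (-lowerCoeff l.total ^ 2 : ℂ) • l.state := by
    by_cases h : l.total = 0
    · simp [h, lowerCoeff_zero]
    · rw [singletContract_extend_sub_one h]
      module
  have normalized : (lowerCoeff l.total ^ 2 + upperCoeff l.total ^ 2 : ℂ) = 1 := by
    exact_mod_cast lowerCoeff_sq_add_upperCoeff_sq l.total
  rw [sigmaVec_eq, map_sub, map_smul, map_smul, lower, singletContract_extend_add_one]
  linear_combination (norm := module) -normalized • l.state

theorem singletContract_nullVec {l : SchurLabel n} (hl : l.total ≠ 0) :
    singletContract l.nullVec = 0 := by
  rw [nullVec_eq, map_add, map_smul, map_smul, singletContract_extend_add_one,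
    singletContract_extend_sub_one hl]
  module

theorem sigmaVec_eq_neg_singletExt (l : SchurLabel n) : l.sigmaVec = -singletExt l.state := by
  rw [← neg_eq_iff_eq_neg, eq_comm]
  refine (inner_eq_one_iff_of_norm_eq_one (𝕜 := ℂ) ?_ ?_).1 ?_
  · rw [norm_singletExt, (orthonormal_state n).norm_eq_one]
  · rw [norm_neg, norm_sigmaVec]
  · rw [inner_singletExt_left, map_neg, singletContract_sigmaVec, neg_neg,
      inner_self_eq_norm_sq_to_K, (orthonormal_state n).norm_eq_one]
    norm_num

theorem hasEigenvector_povm_last_sigmaVec (l : SchurLabel n) :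
    Module.End.HasEigenvector (povm (Fin.last n)).toEnd (sigma (n + 1) l.total) l.sigmaVec := by
  refine Module.End.hasEigenvector_iff.2 ⟨Module.End.mem_eigenspace_iff.2 ?_,
    norm_ne_zero_iff.1 (l.norm_sigmaVec ▸ one_ne_zero)⟩
  rw [sigmaVec_eq_neg_singletExt, map_neg, povm_last_apply, singletContract_singletExt,
    theta_of_spinSq l.spinSq_state, map_smul, smul_neg]

theorem hasEigenvector_povm_last_nullVec {l : SchurLabel n} (hl : l.total ≠ 0) :
    Module.End.HasEigenvector (povm (Fin.last n)).toEnd 0 l.nullVec :=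
  hasEigenvector_povm_last_zero (nullVec_ne_zero hl) (singletContract_nullVec hl)

end SchurLabel

theorem povm_last_eq_zero_of_orthogonal {v : Qubits (n + 2)}
    (hv : ∀ l : SchurLabel n, inner ℂ l.sigmaVec v = 0) :
    (povm (Fin.last n)).toEnd v = 0 := by
  have contract : singletContract v = 0 := by
    refine InnerProductSpace.ext_inner_left_basis (SchurLabel.basis n) fun l => ?_
    rw [SchurLabel.basis_apply, ← inner_singletExt_left, inner_zero_right, ← neg_eq_zero,
      ← inner_neg_left, ← l.sigmaVec_eq_neg_singletExt, hv l]
  rw [povm_last_apply, contract, map_zero, map_zero]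

/-! ### Permutations of the qubits -/

/-- The permutation of the computational basis which moves the value of qubit `i` to qubit `e i`. -/
def qubitPerm (e : Equiv.Perm (Fin n)) : Equiv.Perm (Fin n → Fin 2) :=
  Equiv.arrowCongr e (Equiv.refl _)

/-- Conjugation by the permutation `e` of the qubits; it relabels qubit `i` as qubit `e i`. -/
def permConj (e : Equiv.Perm (Fin n)) : Op n ≃ₐ[ℂ] Op n :=
  reindexAlgEquiv ℂ ℂ (qubitPerm e)

theorem permConj_apply (e : Equiv.Perm (Fin n)) (A : Op n) (x y : Fin n → Fin 2) :
    permConj e A x y = A (x ∘ e) (y ∘ e) :=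
  rfl

theorem permConj_onQubit (e : Equiv.Perm (Fin n)) (A : Matrix (Fin 2) (Fin 2) ℂ) (i : Fin n) :
    permConj e (onQubit A i) = onQubit A (e i) := by
  ext x y
  have agree : (∀ k, k ≠ i → x (e k) = y (e k)) ↔ ∀ k, k ≠ e i → x k = y k :=
    e.forall_congr fun {k} => by rw [ne_eq, ne_eq, e.apply_eq_iff_eq]
  simp only [permConj_apply, onQubit, Function.comp_apply, agree]

theorem permConj_angMom (e : Equiv.Perm (Fin n)) (a : Finset (Fin n)) (c : Fin 3) :
    permConj e (angMom a c) = angMom (a.map e.toEmbedding) c := by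
  simp [angMom, permConj_onQubit]

theorem permConj_spinSq (e : Equiv.Perm (Fin n)) (a : Finset (Fin n)) :
    permConj e (spinSq a) = spinSq (a.map e.toEmbedding) := by
  simp only [spinSq, map_sum, map_mul, permConj_angMom]

theorem commute_permMatrix_iff {e : Equiv.Perm (Fin n)} {A : Op n} :
    Commute ((qubitPerm e).permMatrix ℂ) A ↔ permConj e A = A := by
  rw [commute_iff_eq, Equiv.Perm.permMatrix, PEquiv.toMatrix_toPEquiv_mul,
    PEquiv.mul_toMatrix_toPEquiv]
  constructor <;> intro h <;> ext x y
  · have := congrFun₂ h ((qubitPerm e).symm x) y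
    simp only [submatrix_apply, id, Equiv.apply_symm_apply] at this
    exact this.symm
  · have := congrFun₂ h (qubitPerm e x) y
    simp only [permConj, coe_reindexAlgEquiv, reindex_apply, submatrix_apply,
      Equiv.symm_apply_apply] at this
    exact this.symm

theorem commute_theta {A : Op n} (hA : Commute A (spinSq Finset.univ)) : Commute A (theta n) := by
  refine toEuclideanLin.injective ((SchurLabel.basis n).ext fun l => ?_)
  change Op.toEnd _ _ = Op.toEnd _ _
  have eigen : (spinSq Finset.univ).toEnd (A.toEnd l.state) =
      casimir l.total • A.toEnd l.state := by
    rw [← toEnd_mul_apply, ← hA.eq, toEnd_mul_apply, l.spinSq_state, map_smul]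
  rw [SchurLabel.basis_apply, toEnd_mul_apply, toEnd_mul_apply, theta_of_spinSq l.spinSq_state,
    theta_of_spinSq eigen, map_smul]

theorem permConj_spinSq_univ (e : Equiv.Perm (Fin n)) :
    permConj e (spinSq Finset.univ) = spinSq Finset.univ := by
  rw [permConj_spinSq, Finset.map_univ_equiv]

theorem permConj_theta (e : Equiv.Perm (Fin n)) : permConj e (theta n) = theta n :=
  commute_permMatrix_iff.1 (commute_theta (commute_permMatrix_iff.2 (permConj_spinSq_univ e)))

theorem exists_perm_succAbove {e : Equiv.Perm (Fin (n + 2))}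
    (hlast : e (Fin.last (n + 1)) = Fin.last (n + 1)) {i j : Fin (n + 1)}
    (hij : e i.castSucc = j.castSucc) :
    ∃ e' : Equiv.Perm (Fin n),
      ∀ l, e (i.succAbove l).castSucc = (j.succAbove (e' l)).castSucc := by
  have exists_port (l : Fin n) : ∃ m, e (i.succAbove l).castSucc = (j.succAbove m).castSucc := by
    obtain ⟨k, hk⟩ := Fin.exists_castSucc_eq.2
      (hlast ▸ e.injective.ne (Fin.castSucc_ne_last (i.succAbove l)))
    have hkj : k ≠ j := by
      rintro rfl
      rw [hk, e.apply_eq_iff_eq, Fin.castSucc_inj] at hij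
      exact Fin.succAbove_ne i l hij.symm
    obtain ⟨m, rfl⟩ := Fin.exists_succAbove_eq hkj
    exact ⟨m, hk.symm⟩
  choose f hf using exists_port
  have inj : Function.Injective f := fun l m hlm => by
    have := (hf l).trans (hlm ▸ (hf m).symm)
    simpa using this
  exact ⟨Equiv.ofBijective f (Finite.injective_iff_bijective.1 inj), hf⟩

theorem permConj_povm {e : Equiv.Perm (Fin (n + 2))}
    (hlast : e (Fin.last (n + 1)) = Fin.last (n + 1)) {i j : Fin (n + 1)}
    (hij : e i.castSucc = j.castSucc) : permConj e (povm i) = povm j := by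
  obtain ⟨e', he'⟩ := exists_perm_succAbove hlast hij
  ext x y
  have theta_eq := congrFun₂ (permConj_theta e') (fun l => x (j.succAbove l).castSucc)
    (fun l => y (j.succAbove l).castSucc)
  rw [permConj_apply] at theta_eq
  simp only [permConj_apply, povm, Function.comp_apply, hlast, hij, he', ← theta_eq]
  rfl

theorem swapOp_eq_permMatrix (i j : Fin n) :
    swapOp i j = (qubitPerm (Equiv.swap i j)).permMatrix ℂ := by
  ext x y
  have swap_iff : x = y ∘ Equiv.swap i j ↔ x ∘ Equiv.swap i j = y := by
    constructor <;> rintro rfl <;> funext k <;>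
      simp only [Function.comp_apply, Equiv.swap_apply_self]
  simp only [swapOp, swap_iff, PEquiv.toMatrix_apply, Equiv.toPEquiv_apply, Option.mem_some_iff]
  rfl

theorem swapOp_mul_mul_swapOp (i j : Fin n) (A : Op n) :
    swapOp i j * A * swapOp i j = permConj (Equiv.swap i j) A := by
  rw [swapOp_eq_permMatrix, Equiv.Perm.permMatrix, PEquiv.toMatrix_toPEquiv_mul,
    PEquiv.mul_toMatrix_toPEquiv]
  rfl

theorem swapOp_mul_self (i j : Fin n) : swapOp i j * swapOp i j = 1 := by
  have := swapOp_mul_mul_swapOp i j 1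
  rwa [mul_one, map_one] at this

theorem commute_swapOp_spinSq (i j : Fin n) : Commute (swapOp i j) (spinSq Finset.univ) :=
  swapOp_eq_permMatrix i j ▸ commute_permMatrix_iff.2 (permConj_spinSq_univ _)

theorem povm_eq_swapOp_mul_mul_swapOp (i : Fin (n + 1)) :
    povm i = swapOp i.castSucc (Fin.last n).castSucc * povm (Fin.last n) *
      swapOp i.castSucc (Fin.last n).castSucc := by
  rw [swapOp_mul_mul_swapOp]
  exact (permConj_povm (Equiv.swap_apply_of_ne_of_ne (Fin.castSucc_ne_last _).symm
    (Fin.castSucc_ne_last _).symm) (Equiv.swap_apply_right _ _)).symm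

theorem hasEigenvector_conj {U : Op n} (hU : U * U = 1) {A : Op n} {μ : ℂ} {v : Qubits n}
    (hv : Module.End.HasEigenvector A.toEnd μ v) :
    Module.End.HasEigenvector (Op.toEnd (U * A * U)) μ (U.toEnd v) := by
  have cancel (w : Qubits n) : U.toEnd (U.toEnd w) = w := by
    rw [← toEnd_mul_apply, hU, toEnd_one_apply]
  refine Module.End.hasEigenvector_iff.2 ⟨Module.End.mem_eigenspace_iff.2 ?_, fun h => hv.2 ?_⟩
  · rw [toEnd_mul_apply, toEnd_mul_apply, cancel, hv.apply_eq_smul, map_smul]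
  · rw [← cancel v, h, map_zero]

theorem hasEigenvector_povm_swapOp (i : Fin (n + 1)) {μ : ℂ} {v : Qubits (n + 2)}
    (hv : Module.End.HasEigenvector (povm (Fin.last n)).toEnd μ v) :
    Module.End.HasEigenvector (povm i).toEnd μ
      ((swapOp i.castSucc (Fin.last n).castSucc).toEnd v) := by
  rw [povm_eq_swapOp_mul_mul_swapOp]
  exact hasEigenvector_conj (swapOp_mul_self _ _) hv

/-! ### The failure element -/

/-- The projector `1/4 - S⃗⁽ⁱ⁾ · S⃗⁽ʲ⁾` onto the singlet of two different qubits `i`, `j`. -/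
def singletProj (i j : Fin n) : Op n :=
  (1 / 4 : ℂ) • 1 - ∑ c, angMom {i} c * angMom {j} c

theorem permConj_singletProj (e : Equiv.Perm (Fin n)) (i j : Fin n) :
    permConj e (singletProj i j) = singletProj (e i) (e j) := by
  simp only [singletProj, map_sub, map_smul, map_one, map_sum, map_mul, permConj_angMom,
    Finset.map_singleton, Equiv.coe_toEmbedding]

theorem singlet_mul_star_singlet (a b a' b' : Fin 2) :
    singlet a b * star (singlet a' b') =
      1 / 4 * ((1 : Matrix (Fin 2) (Fin 2) ℂ) a a' * (1 : Matrix (Fin 2) (Fin 2) ℂ) b b' -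
        ∑ c, pauli c a a' * pauli c b b') := by
  fin_cases a <;> fin_cases b <;> fin_cases a' <;> fin_cases b' <;>
    simp [singlet, pauli, Fin.sum_univ_three,
      inv_sqrt_two_mul_inv_sqrt_two] <;> norm_num

theorem onQubit_mul_onQubit_last_snocQubit (A B : Matrix (Fin 2) (Fin 2) ℂ) (b c : Fin 2)
    (v : Qubits n) :
    Op.toEnd (onQubit A (Fin.last n).castSucc * onQubit B (Fin.last (n + 1)))
        (snocQubit c (snocQubit b v)) =
      ∑ b', ∑ c', (A b' b * B c' c) • snocQubit c' (snocQubit b' v) := by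
  simp only [toEnd_mul_apply, onQubit_last_snocQubit, onQubit_castSucc_snocQubit, map_sum, map_smul,
    Finset.smul_sum, smul_smul]
  rw [Finset.sum_comm]
  simp only [mul_comm]

theorem singletExt_singletContract (v : Qubits (n + 2)) :
    singletExt (singletContract v) =
      (singletProj (Fin.last n).castSucc (Fin.last (n + 1))).toEnd v := by
  suffices singletExt ∘ₗ singletContract =
      (singletProj (Fin.last n).castSucc (Fin.last (n + 1))).toEnd from LinearMap.congr_fun this v
  refine linearMap_ext_snocQubit fun c => linearMap_ext_snocQubit fun b => LinearMap.ext fun u => ?_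
  have contract : singletContract (snocQubit c (snocQubit b u)) = star (singlet b c) • u := by
    simp [singletContract_eq_sum, dropQubit_snocQubit, apply_ite, -Fin.sum_univ_two]
  have proj : singletProj (Fin.last n).castSucc (Fin.last (n + 1)) = (1 / 4 : ℂ) •
      (onQubit 1 (Fin.last n).castSucc * onQubit 1 (Fin.last (n + 1)) -
        ∑ k, onQubit (pauli k) (Fin.last n).castSucc * onQubit (pauli k) (Fin.last (n + 1))) := by
    simp only [singletProj, angMom_singleton, smul_mul_smul_comm, onQubit_one, mul_one,
      ← Finset.smul_sum]
    module
  calc singletExt (singletContract (snocQubit c (snocQubit b u)))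
      = ∑ b', ∑ c', (singlet b' c' * star (singlet b c)) • snocQubit c' (snocQubit b' u) := by
        simp only [contract, map_smul, singletExt_eq_sum, Finset.smul_sum, smul_smul, mul_comm]
    _ = _ := by
        rw [LinearMap.comp_apply, LinearMap.comp_apply, proj]
        simp only [map_smul, map_sub, map_sum, LinearMap.smul_apply, LinearMap.sub_apply,
          LinearMap.sum_apply, onQubit_mul_onQubit_last_snocQubit, singlet_mul_star_singlet]
        simp only [Finset.sum_comm (s := Finset.univ (α := Fin 3)), ← Finset.sum_sub_distrib,
          ← Finset.sum_smul, ← sub_smul, Finset.smul_sum, smul_smul]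

theorem povm_of_spinSq {d : ℕ} {v : Qubits (n + 2)}
    (hv : (spinSq Finset.univ).toEnd v = casimir d • v) (i : Fin (n + 1)) :
    (povm i).toEnd v =
      sigma (n + 1) d • (singletProj i.castSucc (Fin.last (n + 1))).toEnd v := by
  set U := swapOp i.castSucc (Fin.last n).castSucc
  have hUv : (spinSq Finset.univ).toEnd (U.toEnd v) = casimir d • U.toEnd v := by
    rw [← toEnd_mul_apply, ← (commute_swapOp_spinSq _ _).eq, toEnd_mul_apply, hv, map_smul]
  have hproj : U * singletProj (Fin.last n).castSucc (Fin.last (n + 1)) * U =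
      singletProj i.castSucc (Fin.last (n + 1)) := by
    rw [swapOp_mul_mul_swapOp, permConj_singletProj, Equiv.swap_apply_right,
      Equiv.swap_apply_of_ne_of_ne (Fin.castSucc_ne_last _).symm (Fin.castSucc_ne_last _).symm]
  rw [povm_eq_swapOp_mul_mul_swapOp, ← hproj, toEnd_mul_apply, toEnd_mul_apply,
    povm_last_of_spinSq hUv, singletExt_singletContract, map_smul, ← toEnd_mul_apply,
    ← toEnd_mul_apply]

theorem spinSq_insert {a : Finset (Fin n)} {j : Fin n} (hj : j ∉ a) :
    spinSq (insert j a) =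
      (3 / 4 : ℂ) • 1 + spinSq a + (2 : ℂ) • ∑ c, angMom a c * angMom {j} c := by
  have single (c : Fin 3) : angMom {j} c * angMom {j} c = (1 / 4 : ℂ) • 1 := by
    rw [angMom_singleton, smul_mul_smul_comm, onQubit_mul_onQubit, pauli_mul_self, onQubit_one]
    norm_num
  have comm (c : Fin 3) : angMom {j} c * angMom a c = angMom a c * angMom {j} c :=
    commute_angMom (Finset.disjoint_singleton_left.2 hj) c c
  simp only [spinSq, angMom_insert hj, add_mul, mul_add, single, comm, Fin.sum_univ_three]
  module

theorem sum_singletProj {a : Finset (Fin n)} {j : Fin n} (hj : j ∉ a) :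
    ∑ i ∈ a, singletProj i j =
      ((a.card : ℂ) / 4 + 3 / 8) • 1 - (1 / 2 : ℂ) • (spinSq (insert j a) - spinSq a) := by
  have coupling : ∑ i ∈ a, ∑ c, angMom {i} c * angMom {j} c = ∑ c, angMom a c * angMom {j} c := by
    rw [Finset.sum_comm]
    simp only [← Finset.sum_mul, angMom_singleton]
    rfl
  simp only [singletProj, Finset.sum_sub_distrib, Finset.sum_const, coupling, spinSq_insert hj,
    ← Nat.cast_smul_eq_nsmul ℂ]
  module

/-- The eigenvalue `τ(s) = 2 (2 s + 1) / (N + 3 + 2 s)` of `Π_{N+1}` for the spin `s = d / 2`. -/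
def tau (N d : ℕ) : ℂ := 2 * (2 * ((d : ℂ) / 2) + 1) / ((N : ℂ) + 3 + 2 * ((d : ℂ) / 2))

theorem povmFail_of_spinSq {d e : ℕ} {v : Qubits (n + 2)}
    (hd : (spinSq Finset.univ).toEnd v = casimir d • v)
    (he : (spinSq (Finset.univ.map Fin.castSuccEmb)).toEnd v = casimir e • v) :
    (povmFail n).toEnd v = (1 - sigma (n + 1) d *
      (((n + 1 : ℕ) : ℂ) / 4 + 3 / 8 - 1 / 2 * (casimir d - casimir e))) • v := by
  have hlast : Fin.last (n + 1) ∉ Finset.univ.map Fin.castSuccEmb := by simp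
  have total := LinearMap.congr_fun (congrArg Op.toEnd (sum_singletProj hlast)) v
  rw [← Finset.cons_eq_insert _ _ hlast, ← Fin.univ_castSuccEmb] at total
  simp only [Finset.sum_map, Fin.coe_castSuccEmb, Finset.card_map, Finset.card_univ,
    Fintype.card_fin, map_sum, map_sub, map_smul, LinearMap.sum_apply, LinearMap.sub_apply,
    LinearMap.smul_apply, toEnd_one_apply, hd, he] at total
  simp only [povmFail, map_sub, map_sum, LinearMap.sub_apply, LinearMap.sum_apply, toEnd_one_apply,
    povm_of_spinSq hd, ← Finset.smul_sum, total]
  module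

theorem one_sub_sigma_mul_add_one (N e : ℕ) :
    1 - sigma N (e + 1) * ((N : ℂ) / 4 + 3 / 8 - 1 / 2 * (casimir (e + 1) - casimir e)) =
      tau N (e + 1) := by
  have := natCast_add_three_ne_zero N (e + 1)
  rw [sigma, tau, casimir, casimir, eq_div_iff this, sub_mul, mul_right_comm,
    div_mul_cancel₀ _ this]
  push_cast
  ring

theorem one_sub_sigma_mul_sub_one (N d : ℕ) :
    1 - sigma N d * ((N : ℂ) / 4 + 3 / 8 - 1 / 2 * (casimir d - casimir (d + 1))) = 0 := by
  have := natCast_add_three_ne_zero N d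
  rw [sigma, casimir, casimir, div_mul_eq_mul_div, sub_eq_zero, eq_div_iff this]
  push_cast
  ring

namespace SchurLabel

theorem spinSq_map_castSucc_state (l : SchurLabel (n + 1)) :
    (spinSq (Finset.univ.map Fin.castSuccEmb)).toEnd l.state =
      casimir (l.spin (Fin.last n).castSucc) • l.state := by
  have initial := (l.hasEigenvector_spinSq (Fin.last n).castSucc).apply_eq_smul
  rwa [Fin.val_castSucc, filter_lt_eq_map_castSucc (Fin.last n).is_le,
    Finset.filter_true_of_mem fun i _ => i.is_lt] at initial

theorem hasEigenvector_povmFail (l : SchurLabel (n + 2)) :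
    Module.End.HasEigenvector (povmFail n).toEnd (1 - sigma (n + 1) l.total *
      (((n + 1 : ℕ) : ℂ) / 4 + 3 / 8 - 1 / 2 *
        (casimir l.total - casimir (l.spin (Fin.last (n + 1)).castSucc)))) l.state :=
  Module.End.hasEigenvector_iff.2 ⟨Module.End.mem_eigenspace_iff.2 <|
    povmFail_of_spinSq l.spinSq_state l.spinSq_map_castSucc_state, l.state_ne_zero⟩

theorem hasEigenvector_povmFail_tau {l : SchurLabel (n + 2)}
    (hl : l.total = l.spin (Fin.last (n + 1)).castSucc + 1) :
    Module.End.HasEigenvector (povmFail n).toEnd (tau (n + 1) l.total) l.state := by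
  have := l.hasEigenvector_povmFail
  rwa [hl, one_sub_sigma_mul_add_one, ← hl] at this

theorem hasEigenvector_povmFail_zero {l : SchurLabel (n + 2)}
    (hl : l.total + 1 = l.spin (Fin.last (n + 1)).castSucc) :
    Module.End.HasEigenvector (povmFail n).toEnd 0 l.state := by
  have := l.hasEigenvector_povmFail
  rwa [← hl, one_sub_sigma_mul_sub_one] at this

end SchurLabel

end

end PBT

theorem mainTheorem2 (n N : ℕ) (hN : N = n + 1) :
    -- the Schur states of the `N + 1 = n + 2` qubits are an orthonormal basis of simultaneous
    -- eigenvectors of the spin operators of the initial segments and of `Z`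
    (Orthonormal ℂ (PBT.SchurLabel.state : PBT.SchurLabel (n + 2) → PBT.Qubits (n + 2)) ∧
      Submodule.span ℂ (Set.range
        (PBT.SchurLabel.state : PBT.SchurLabel (n + 2) → PBT.Qubits (n + 2))) = ⊤ ∧
      (∀ l : PBT.SchurLabel (n + 2),
        (∀ r : Fin (n + 3), Module.End.HasEigenvector
          (PBT.spinSq (Finset.univ.filter fun i : Fin (n + 2) => (i : ℕ) < (r : ℕ))).toEnd
          (PBT.casimir (l.spin r)) l.state) ∧
        Module.End.HasEigenvector
          (PBT.spinZ (Finset.univ : Finset (Fin (n + 2)))).toEnd ((l.zspin : ℂ) / 2) l.state)) ∧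
    -- `Π_N`: the eigenvalue `σ(s) = 4 / (N + 3 + 2 s)`
    (∀ l : PBT.SchurLabel n, Module.End.HasEigenvector (PBT.povm (Fin.last n)).toEnd
      (4 / ((N : ℂ) + 3 + 2 * ((l.total : ℂ) / 2))) l.sigmaVec) ∧
    -- `Π_N`: the eigenvalue `0`
    (∀ l : PBT.SchurLabel (n + 2),
      l.spin (Fin.last n).castSucc.castSucc ≠ l.total →
      Module.End.HasEigenvector (PBT.povm (Fin.last n)).toEnd 0 l.state) ∧
    (∀ l : PBT.SchurLabel n, l.total ≠ 0 →
      Module.End.HasEigenvector (PBT.povm (Fin.last n)).toEnd 0 l.nullVec) ∧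
    (∀ v : PBT.Qubits (n + 2), (∀ l : PBT.SchurLabel n, inner ℂ l.sigmaVec v = 0) →
      (PBT.povm (Fin.last n)).toEnd v = 0) ∧
    -- `Π_i = SWAP_{A_i A_N} Π_N SWAP_{A_i A_N}`, so that `SWAP` carries eigenvectors to eigenvectors
    (∀ i : Fin (n + 1),
      PBT.povm i = PBT.swapOp i.castSucc (Fin.last n).castSucc * PBT.povm (Fin.last n) *
        PBT.swapOp i.castSucc (Fin.last n).castSucc ∧
      ∀ (μ : ℂ) (v : PBT.Qubits (n + 2)),
        Module.End.HasEigenvector (PBT.povm (Fin.last n)).toEnd μ v →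
        Module.End.HasEigenvector (PBT.povm i).toEnd μ
          ((PBT.swapOp i.castSucc (Fin.last n).castSucc).toEnd v)) ∧
    -- `Π_{N+1}` on the Schur basis
    (∀ l : PBT.SchurLabel (n + 2),
      (l.total = l.spin (Fin.last (n + 1)).castSucc + 1 →
        Module.End.HasEigenvector (PBT.povmFail n).toEnd
          (2 * (2 * ((l.total : ℂ) / 2) + 1) / ((N : ℂ) + 3 + 2 * ((l.total : ℂ) / 2)))
          l.state) ∧
      (l.total + 1 = l.spin (Fin.last (n + 1)).castSucc →
        Module.End.HasEigenvector (PBT.povmFail n).toEnd 0 l.state)) := by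
  subst hN
  refine ⟨⟨PBT.SchurLabel.orthonormal_state _, PBT.SchurLabel.span_state _, fun l =>
    ⟨l.hasEigenvector_spinSq, l.hasEigenvector_spinZ⟩⟩, ?sigma, ?zero, ?null, ?orthogonal, ?swap,
    ?fail⟩
  case sigma => exact fun l => l.hasEigenvector_povm_last_sigmaVec
  case zero => exact fun l hl => l.hasEigenvector_povm_last_state hl
  case null => exact fun l hl => l.hasEigenvector_povm_last_nullVec hl
  case orthogonal => exact fun v hv => PBT.povm_last_eq_zero_of_orthogonal hv
  case swap => exact fun i =>
    ⟨PBT.povm_eq_swapOp_mul_mul_swapOp i, fun μ v hv => PBT.hasEigenvector_povm_swapOp i hv⟩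
  case fail => exact fun l =>
    ⟨fun h => l.hasEigenvector_povmFail_tau h, fun h => l.hasEigenvector_povmFail_zero h⟩
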